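/- Let $\mathcal F$ be $\mathbb R$ or $\mathbb C$, and let $m=2$ if $\mathcal F=\mathbb R$ and $m=3$ if $\mathcal F=\mathbb C$. Let $A_0,A_1,\dots,A_m$ be $n\times n$ Hermitian matrices over $\mathcal F$, let $c_1,\dots,c_m\in\mathbb R$ with $c_m\neq 0$, and let each $\unlhd_i$ be either $\le$ or $=$. Consider $$(HQP)\quad \min\{x^HA_0x : x\in\mathcal F^n,\ x^HA_ix\unlhd_i c_i,\ i=1,\dots,m\},$$ its semidefinite relaxation, where $A\bullet X=\operatorname{tr}(X^HA)$, $$(SP)\quad \min\{A_0\bullet X : X\succeq 0,\ A_i\bullet X\unlhd_i c_i,\ i=1,\dots,m\},$$ and the dual of the latter, $$(SD)\quad \max\Big\{-\sum_{i=1}^m c_i\mu_i : Z=A_0+\sum_{i=1}^m\mu_iA_i\succeq 0,\ \mu\in\mathbb R^m,\ \mu_i\ge 0 \text{ whenever } \unlhd_i \text{ is } \le\Big\}.$$ Assume that both (SP) and (SD) satisfy the Slater condition: there is $\tilde X\succ 0$ with $A_i\bullet\tilde X<c_i$ whenever $\unlhd_i$ is $\le$ and $A_i\bullet\tilde X=c_i$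 whenever $\unlhd_i$ is $=$, and there is $\tilde\mu\in\mathbb R^m$ with $A_0+\sum_{i=1}^m\tilde\mu_iA_i\succ 0$ and $\tilde\mu_i>0$ whenever $\unlhd_i$ is $\le$. Then (HQP) has an optimal solution, and the optimal values of (HQP) and (SP) are equal. Moreover, an optimal solution of (HQP) can be found in polynomial time from any optimal solution $\hat X$ of (SP) together with any optimal solution $(\hat Z,\hat\mu)$ of (SD): for each of the two fields there are one program of a real random access machine and one polynomial $p$ such that, for every $n$, every instance as above and every such optimal pair, the program, started on the data $n,A_0,\dots,A_m,c,\unlhd,\hat X,\hat Z,\hat\mu$, halts after at most $p(n)$ elementary steps with an optimal solution of (HQP) as its output. Here the elementary steps are exact real additions, subtractions, multiplications, divisions and square roots, comparisons of two real numbers, reading and writing of memory cells, and additions, subtractions and comparisons of indices. -/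

import Mathlib

open scoped ComplexOrder Matrix

noncomputable section

/-! ## Homogeneous quadratic programs, their semidefinite relaxations and the dual programs -/

/-- `m_𝕜`: the real dimension of the field `𝕜`, i.e. `1` for `ℝ` and `2` for `ℂ`. -/
def fieldDim (𝕜 : Type*) [RCLike 𝕜] : ℕ := Module.finrank ℝ 𝕜

theorem fieldDim_real : fieldDim ℝ = 1 := Module.finrank_self ℝ

theorem fieldDim_complex : fieldDim ℂ = 2 := Complex.finrank_real_complex

/-- The sense of a constraint: an inequality `≤` or an equality `=`. -/
inductive Sense where
  | le : Sense
  | eq : Sense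

/-- The relation `a ⊴ b` of a constraint. -/
def Sense.Holds : Sense → ℝ → ℝ → Prop
  | .le, a, b => a ≤ b
  | .eq, a, b => a = b

/-- The strict form of a constraint: inequalities become strict, equalities stay. -/
def Sense.HoldsStrictly : Sense → ℝ → ℝ → Prop
  | .le, a, b => a < b
  | .eq, a, b => a = b

/-- Sign condition on the multiplier of a constraint. -/
def Sense.DualSign : Sense → ℝ → Prop
  | .le, t => 0 ≤ t
  | .eq, _ => True

/-- Strict sign condition on the multiplier of a constraint. -/
def Sense.StrictDualSign : Sense → ℝ → Prop
  | .le, t => 0 < t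
  | .eq, _ => True

/-- Numerical code of the sense of a constraint, used when it is part of an input. -/
def Sense.code : Sense → ℝ
  | .le => 0
  | .eq => 1

/-- The data of the problem: minimize `xᴴ A₀ x` subject to `xᴴ Aᵢ x ⊴ᵢ cᵢ`, `i = 1, …, m`,
with Hermitian `n × n` matrices over `𝕜`. -/
structure HQP (𝕜 : Type*) [RCLike 𝕜] (n m : ℕ) where
  A₀ : Matrix (Fin n) (Fin n) 𝕜
  A : Fin m → Matrix (Fin n) (Fin n) 𝕜
  c : Fin m → ℝ
  sense : Fin m → Sense
  hermitian₀ : A₀.IsHermitian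
  hermitian : ∀ i, (A i).IsHermitian

/-- The value `xᴴ A x` (which is real for Hermitian `A`). -/
def quadForm {𝕜 : Type*} [RCLike 𝕜] {n : ℕ} (A : Matrix (Fin n) (Fin n) 𝕜) (x : Fin n → 𝕜) : ℝ :=
  RCLike.re (star x ⬝ᵥ (A *ᵥ x))

/-- The inner product `A • B = tr (Bᴴ A)` (which is real for Hermitian `A`, `B`). -/
def matInner {𝕜 : Type*} [RCLike 𝕜] {n : ℕ} (A B : Matrix (Fin n) (Fin n) 𝕜) : ℝ :=
  RCLike.re (Bᴴ * A).trace

namespace HQP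

variable {𝕜 : Type*} [RCLike 𝕜] {n m : ℕ}

/-- Feasible points of the quadratic program. -/
def Feasible (P : HQP 𝕜 n m) (x : Fin n → 𝕜) : Prop :=
  ∀ i, (P.sense i).Holds (quadForm (P.A i) x) (P.c i)

/-- Optimal solutions (global minimizers) of the quadratic program. -/
def IsOptimal (P : HQP 𝕜 n m) (x : Fin n → 𝕜) : Prop :=
  P.Feasible x ∧ ∀ y, P.Feasible y → quadForm P.A₀ x ≤ quadForm P.A₀ y

/-- The optimal value of the quadratic program (`⊤` if it is infeasible). -/
def value (P : HQP 𝕜 n m) : EReal :=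
  ⨅ (x : Fin n → 𝕜) (_ : P.Feasible x), ((quadForm P.A₀ x : ℝ) : EReal)

/-- Feasible points of the semidefinite relaxation. -/
def SDPFeasible (P : HQP 𝕜 n m) (X : Matrix (Fin n) (Fin n) 𝕜) : Prop :=
  X.PosSemidef ∧ ∀ i, (P.sense i).Holds (matInner (P.A i) X) (P.c i)

/-- Optimal solutions of the semidefinite relaxation. -/
def IsSDPOptimal (P : HQP 𝕜 n m) (X : Matrix (Fin n) (Fin n) 𝕜) : Prop :=
  P.SDPFeasible X ∧ ∀ Y, P.SDPFeasible Y → matInner P.A₀ X ≤ matInner P.A₀ Y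

/-- The optimal value of the semidefinite relaxation. -/
def sdpValue (P : HQP 𝕜 n m) : EReal :=
  ⨅ (X : Matrix (Fin n) (Fin n) 𝕜) (_ : P.SDPFeasible X), ((matInner P.A₀ X : ℝ) : EReal)

/-- The matrix `A₀ + ∑ μᵢ Aᵢ`. -/
def dualMatrix (P : HQP 𝕜 n m) (μ : Fin m → ℝ) : Matrix (Fin n) (Fin n) 𝕜 :=
  P.A₀ + ∑ i, ((μ i : ℝ) : 𝕜) • P.A i

/-- Feasible points `(Z, μ)` of the dual of the semidefinite relaxation. -/
def DualFeasible (P : HQP 𝕜 n m) (Z : Matrix (Fin n) (Fin n) 𝕜) (μ : Fin m → ℝ) : Prop :=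
  Z = P.dualMatrix μ ∧ Z.PosSemidef ∧ ∀ i, (P.sense i).DualSign (μ i)

/-- The dual objective `-∑ cᵢ μᵢ`. -/
def dualObjective (P : HQP 𝕜 n m) (μ : Fin m → ℝ) : ℝ := -∑ i, P.c i * μ i

/-- Optimal solutions `(Z, μ)` of the dual of the semidefinite relaxation. -/
def IsDualOptimal (P : HQP 𝕜 n m) (Z : Matrix (Fin n) (Fin n) 𝕜) (μ : Fin m → ℝ) : Prop :=
  P.DualFeasible Z μ ∧
    ∀ W ν, P.DualFeasible W ν → P.dualObjective ν ≤ P.dualObjective μ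

/-- Slater condition for the semidefinite relaxation. -/
def PrimalSlater (P : HQP 𝕜 n m) : Prop :=
  ∃ X : Matrix (Fin n) (Fin n) 𝕜,
    X.PosDef ∧ ∀ i, (P.sense i).HoldsStrictly (matInner (P.A i) X) (P.c i)

/-- Slater condition for the dual of the semidefinite relaxation. -/
def DualSlater (P : HQP 𝕜 n m) : Prop :=
  ∃ μ : Fin m → ℝ, (P.dualMatrix μ).PosDef ∧ ∀ i, (P.sense i).StrictDualSign (μ i)

end HQP

/-! ## Real random access machines

A program manipulates finitely many index registers (holding natural numbers) and finitely many
two-dimensional arrays of real numbers, both named by natural numbers. The exact real operations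
`+`, `-`, `*`, `/`, `√` and the comparison of two reals are elementary steps; real numbers can never
be turned into indices. Division by zero and the square root of a negative number return `0`. -/

namespace RealRAM

/-- A memory state. -/
structure State where
  /-- contents of the index registers -/
  idx : ℕ → ℕ
  /-- contents of the arrays: `mem a i j` is the entry `(i, j)` of array `a` -/
  mem : ℕ → ℕ → ℕ → ℝ

/-- Index expressions; `sub` is truncated subtraction. -/
inductive IdxExpr where
  | const (k : ℕ) : IdxExpr
  | reg (r : ℕ) : IdxExpr
  | add (e f : IdxExpr) : IdxExpr
  | sub (e f : IdxExpr) : IdxExpr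

/-- Real expressions; the only constants are rational numbers. -/
inductive RealExpr where
  | const (q : ℚ) : RealExpr
  | cell (a : ℕ) (i j : IdxExpr) : RealExpr
  | add (e f : RealExpr) : RealExpr
  | sub (e f : RealExpr) : RealExpr
  | mul (e f : RealExpr) : RealExpr
  | div (e f : RealExpr) : RealExpr
  | sqrt (e : RealExpr) : RealExpr

/-- Tests: strict comparison of two real numbers or of two indices. -/
inductive Test where
  | realLt (e f : RealExpr) : Test
  | idxLt (e f : IdxExpr) : Test

/-- Programs: assignments, composition, branching and while loops. -/
inductive Program where
  | skip : Program
  | setIdx (r : ℕ) (e : IdxExpr) : Program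
  | setCell (a : ℕ) (i j : IdxExpr) (e : RealExpr) : Program
  | seq (p q : Program) : Program
  | branch (b : Test) (p q : Program) : Program
  | loop (b : Test) (p : Program) : Program

def IdxExpr.eval (s : State) : IdxExpr → ℕ
  | .const k => k
  | .reg r => s.idx r
  | .add e f => e.eval s + f.eval s
  | .sub e f => e.eval s - f.eval s

/-- Number of elementary steps needed to evaluate an index expression. -/
def IdxExpr.cost : IdxExpr → ℕ
  | .const _ => 1
  | .reg _ => 1
  | .add e f => e.cost + f.cost + 1
  | .sub e f => e.cost + f.cost + 1

def RealExpr.eval (s : State) : RealExpr → ℝ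
  | .const q => (q : ℝ)
  | .cell a i j => s.mem a (i.eval s) (j.eval s)
  | .add e f => e.eval s + f.eval s
  | .sub e f => e.eval s - f.eval s
  | .mul e f => e.eval s * f.eval s
  | .div e f => e.eval s / f.eval s
  | .sqrt e => Real.sqrt (e.eval s)

/-- Number of elementary steps needed to evaluate a real expression. -/
def RealExpr.cost : RealExpr → ℕ
  | .const _ => 1
  | .cell _ i j => i.cost + j.cost + 1
  | .add e f => e.cost + f.cost + 1
  | .sub e f => e.cost + f.cost + 1
  | .mul e f => e.cost + f.cost + 1
  | .div e f => e.cost + f.cost + 1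
  | .sqrt e => e.cost + 1

def Test.Holds (s : State) : Test → Prop
  | .realLt e f => e.eval s < f.eval s
  | .idxLt e f => e.eval s < f.eval s

/-- Number of elementary steps needed to perform a test. -/
def Test.cost : Test → ℕ
  | .realLt e f => e.cost + f.cost + 1
  | .idxLt e f => e.cost + f.cost + 1

/-- The state after writing `k` into index register `r`. -/
def State.writeIdx (s : State) (r k : ℕ) : State :=
  { s with idx := Function.update s.idx r k }

/-- The state after writing `v` into the entry `(i, j)` of array `a`. -/
def State.writeCell (s : State) (a i j : ℕ) (v : ℝ) : State :=
  { s with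
    mem := fun a' i' j' => if a' = a ∧ i' = i ∧ j' = j then v else s.mem a' i' j' }

/-- `Runs p s t s'`: started in state `s`, the program `p` halts after exactly `t` elementary steps
in state `s'`. -/
inductive Runs : Program → State → ℕ → State → Prop where
  | skip (s : State) : Runs .skip s 1 s
  | setIdx (s : State) (r : ℕ) (e : IdxExpr) :
      Runs (.setIdx r e) s (e.cost + 1) (s.writeIdx r (e.eval s))
  | setCell (s : State) (a : ℕ) (i j : IdxExpr) (e : RealExpr) :
      Runs (.setCell a i j e) s (i.cost + j.cost + e.cost + 1)
        (s.writeCell a (i.eval s) (j.eval s) (e.eval s))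
  | seq {p q : Program} {s s' s'' : State} {t t' : ℕ} :
      Runs p s t s' → Runs q s' t' s'' → Runs (.seq p q) s (t + t') s''
  | branchTrue {b : Test} {p q : Program} {s s' : State} {t : ℕ} :
      b.Holds s → Runs p s t s' → Runs (.branch b p q) s (b.cost + t) s'
  | branchFalse {b : Test} {p q : Program} {s s' : State} {t : ℕ} :
      ¬ b.Holds s → Runs q s t s' → Runs (.branch b p q) s (b.cost + t) s'
  | loopTrue {b : Test} {p : Program} {s s' s'' : State} {t t' : ℕ} :
      b.Holds s → Runs p s t s' → Runs (.loop b p) s' t' s'' →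
        Runs (.loop b p) s (b.cost + t + t') s''
  | loopFalse {b : Test} {p : Program} {s : State} :
      ¬ b.Holds s → Runs (.loop b p) s b.cost s

/-- A real matrix as an array, with zeros outside its range. -/
def ofMatrix {n : ℕ} (M : Matrix (Fin n) (Fin n) ℝ) : ℕ → ℕ → ℝ := fun i j =>
  if h : i < n ∧ j < n then M ⟨i, h.1⟩ ⟨j, h.2⟩ else 0

/-- A real vector as column `0` of an array, with zeros elsewhere. -/
def ofVector {m : ℕ} (v : Fin m → ℝ) : ℕ → ℕ → ℝ := fun i j =>
  if h : i < m ∧ j = 0 then v ⟨i, h.1⟩ else 0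

/-- Real parts of the entries of a matrix. -/
def rePart {𝕜 : Type*} [RCLike 𝕜] {n : ℕ} (M : Matrix (Fin n) (Fin n) 𝕜) :
    Matrix (Fin n) (Fin n) ℝ := M.map (fun z => RCLike.re z)

/-- Imaginary parts of the entries of a matrix. -/
def imPart {𝕜 : Type*} [RCLike 𝕜] {n : ℕ} (M : Matrix (Fin n) (Fin n) 𝕜) :
    Matrix (Fin n) (Fin n) ℝ := M.map (fun z => RCLike.im z)

/-- The matrices `A₁, …, Aₘ` as arrays: array `2 k` holds the real parts and array `2 k + 1` the
imaginary parts of the `k`-th matrix (counted from `0`); the other arrays are zero. -/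
def ofMatrices {𝕜 : Type*} [RCLike 𝕜] {n m : ℕ} (A : Fin m → Matrix (Fin n) (Fin n) 𝕜) :
    ℕ → ℕ → ℕ → ℝ := fun a =>
  if h : a / 2 < m then
    if a % 2 = 0 then ofMatrix (rePart (A ⟨a / 2, h⟩)) else ofMatrix (imPart (A ⟨a / 2, h⟩))
  else fun _ _ => 0

/-- The initial state for the input consisting of a quadratic program, a matrix `X` and a pair
`(Z, μ)`. Register `0` holds the dimension `n`, the other registers hold `0`. Array `0` (reserved
for the output) is zero; array `1` holds `c`, array `2` the senses of the constraints, array `3` the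
multipliers `μ`; the arrays from `4` on hold the real and imaginary parts of `X`, `Z`, `A₀`,
`A₁, …, Aₘ` in this order; all further arrays are zero. -/
def initialState {𝕜 : Type*} [RCLike 𝕜] {n m : ℕ} (P : HQP 𝕜 n m)
    (X Z : Matrix (Fin n) (Fin n) 𝕜) (μ : Fin m → ℝ) : State where
  idx := fun r => if r = 0 then n else 0
  mem := fun a =>
    match a with
    | 0 => fun _ _ => 0
    | 1 => ofVector P.c
    | 2 => ofVector (fun i => (P.sense i).code)
    | 3 => ofVector μ
    | 4 => ofMatrix (rePart X)
    | 5 => ofMatrix (imPart X)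
    | 6 => ofMatrix (rePart Z)
    | 7 => ofMatrix (imPart Z)
    | 8 => ofMatrix (rePart P.A₀)
    | 9 => ofMatrix (imPart P.A₀)
    | a + 10 => ofMatrices P.A a

/-- The vector `x` is written in array `0`: real parts in column `0`, imaginary parts in
column `1`. -/
def Outputs {𝕜 : Type*} [RCLike 𝕜] {n : ℕ} (s : State) (x : Fin n → 𝕜) : Prop :=
  ∀ i : Fin n, s.mem 0 i 0 = RCLike.re (x i) ∧ s.mem 0 i 1 = RCLike.im (x i)

end RealRAM

end

/-!
The relaxation replaces `x xᴴ` by a positive semidefinite matrix `X`, so an optimal `X` of rank one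
gives an optimal `x`. The proof produces from any optimal `X` a vector `w` in the range of `X` with
`wᴴ Aᵢ w = Aᵢ • X` for all constraints. Then `w wᴴ` is feasible, and its objective value is that of
`X`: since `w` lies in the range of `X`, the matrix `(1 + ε) X - ε w wᴴ` is feasible for small
`ε > 0`, and optimality of `X` gives `wᴴ A₀ w ≤ A₀ • X`
(`HQP.IsSDPOptimal.isOptimal_of_dominatedBy`).

The vector `w` is built by writing `X` as a sum of dyads `v vᴴ` (Cholesky factorization,
`cholRest_posSemidef`) and merging the vectors one by one. To merge `w` and `v`, look for a
combination `z₀ w + conj(z₁) v` that takes the value `wᴴ Aᵢ w + vᴴ Aᵢ v` on each form. The matrix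
`z zᴴ` has to differ from the identity by a multiple of a Hermitian `2 × 2` matrix `D` in the kernel
of `m` real linear equations. The space of such `D` has dimension `3` over `ℝ` and `4` over `ℂ`,
one more than the number of equations, so there is a nonzero `D`; normalized such that its larger
eigenvalue `l` is positive and not smaller than the absolute value of the other one, it gives the
singular positive semidefinite matrix `1 - D / l = z zᴴ` (`mergeCoeff_spec`, `quadForm_combine`).
Over `ℝ`, a third equation that makes the imaginary part of `D` vanish reduces this to the complex
case. Both `D`, by Gram–Schmidt in `ℝ⁴`, and `z` are given by closed formulas in the arithmetic operations
and square roots; case distinctions are expressed through `x / x`, which is `1` or `0`.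

On a real random access machine these steps are loops over the indices with straight-line bodies.
`RealRAM.Triple` is a Hoare logic with polynomial time bounds, in which `RealRAM.solveProg_spec`
verifies the program. The dual Slater condition makes the relevant part of the feasible set of the relaxation compact, so that an optimal `X` exists
(`HQP.exists_isSDPOptimal`); applied to it, the correctness of the program also yields the existence
of an optimal solution and the equality of the values.
-/

noncomputable section

/-! ### Straight-line formulas over an arbitrary arithmetic structure -/

section StraightLine

variable {α : Type*} [Add α] [Sub α] [Mul α] [Div α] [Zero α] [One α]

/-- The inner product of two vectors with four entries. -/
def dot4 (u v : Fin 4 → α) : α := u 0 * v 0 + u 1 * v 1 + u 2 * v 2 + u 3 * v 3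

/-- The standard basis vectors of length four. -/
def unit4 (j : Fin 4) : Fin 4 → α := fun i => if i = j then 1 else 0

/-- The indicator of `x = 0`, written without a case distinction: it uses `0 / 0 = 0`. -/
def zeroIndicator (x : α) : α := 1 - x / x

/-- The normalized vector `u / |u|`, which is `0` for `u = 0`. -/
def normalize4 (sq : α → α) (u : Fin 4 → α) : Fin 4 → α := fun i => u i / sq (dot4 u u)

/-- The component of `u` orthogonal to `q`, for `q` of length one or zero. -/
def reject4 (q u : Fin 4 → α) : Fin 4 → α := fun i => u i - dot4 q u * q i

/-- The Gram–Schmidt vectors of three vectors with four entries. A vector that depends on the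
preceding ones yields the vector `0`. -/
def gramSchmidt4 (sq : α → α) (r : Fin 3 → Fin 4 → α) : Fin 3 → Fin 4 → α :=
  let q₀ := normalize4 sq (r 0)
  let q₁ := normalize4 sq (reject4 q₀ (r 1))
  ![q₀, q₁, normalize4 sq (reject4 q₁ (reject4 q₀ (r 2)))]

/-- The component of the `j`-th unit vector orthogonal to the rows `q`. -/
def rejectUnit4 (q : Fin 3 → Fin 4 → α) (j : Fin 4) : Fin 4 → α :=
  reject4 (q 2) (reject4 (q 1) (reject4 (q 0) (unit4 j)))

/-- The first of the four vectors `p j` whose `j`-th entry is not zero. -/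
def firstNonzero4 (p : Fin 4 → Fin 4 → α) : Fin 4 → α := fun i =>
  p 0 0 / p 0 0 * p 0 i + zeroIndicator (p 0 0) *
    (p 1 1 / p 1 1 * p 1 i + zeroIndicator (p 1 1) *
      (p 2 2 / p 2 2 * p 2 i + zeroIndicator (p 2 2) * p 3 i))

/-- A nonzero vector orthogonal to three given vectors with four entries. -/
def nullVec (sq : α → α) (r : Fin 3 → Fin 4 → α) : Fin 4 → α :=
  firstNonzero4 (rejectUnit4 (gramSchmidt4 sq r))

/-- The vector `d` or `-d`, chosen such that `d 0 + d 1 ≥ 0`. -/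
def orient4 (sq : α → α) (d : Fin 4 → α) : Fin 4 → α := fun i =>
  ((d 0 + d 1) / sq ((d 0 + d 1) * (d 0 + d 1)) + zeroIndicator (d 0 + d 1)) * d i

/-- The larger eigenvalue of the Hermitian matrix with diagonal `d 0`, `d 1` and off-diagonal entry
`d 2 + d 3 I`. -/
def topEigenvalue (sq : α → α) (d : Fin 4 → α) : α :=
  (d 0 + d 1 + sq ((d 0 - d 1) * (d 0 - d 1) +
    (1 + 1) * (1 + 1) * (d 2 * d 2 + d 3 * d 3))) / (1 + 1)

/-- With `D` the Hermitian matrix of `d` and `l` its larger eigenvalue, the matrix `1 - D / l` is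
positive semidefinite and singular, hence equal to `z zᴴ` with `z 0` real. The entries of the
result are `z 0` and the real and imaginary parts of `conj (z 1)`. -/
def rankOneFactor (sq : α → α) (d : Fin 4 → α) : Fin 3 → α :=
  let l := topEigenvalue sq d
  let a := sq ((l - d 0) / l)
  ![a, zeroIndicator a * sq ((l - d 1) / l) - d 2 / (l * a), 0 - d 3 / (l * a)]

/-- The coefficients of the combination of two vectors that replaces the two vectors. -/
def mergeCoeff (sq : α → α) (r : Fin 3 → Fin 4 → α) : Fin 3 → α :=
  rankOneFactor sq (orient4 sq (nullVec sq r))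

end StraightLine

section RealStraightLine

theorem zeroIndicator_zero : zeroIndicator (0 : ℝ) = 1 := by simp [zeroIndicator]

theorem zeroIndicator_of_ne_zero {x : ℝ} (hx : x ≠ 0) : zeroIndicator x = 0 := by
  simp [zeroIndicator, hx]

theorem dot4_comm (u v : Fin 4 → ℝ) : dot4 u v = dot4 v u := by
  simp only [dot4]; ring

theorem dot4_reject4 (x q u : Fin 4 → ℝ) :
    dot4 x (reject4 q u) = dot4 x u - dot4 q u * dot4 x q := by
  simp only [dot4, reject4]; ring

theorem dot4_smul (c : ℝ) (x u : Fin 4 → ℝ) : dot4 x (c • u) = c * dot4 x u := by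
  simp only [dot4, Pi.smul_apply, smul_eq_mul]; ring

theorem dot4_unit4 (x : Fin 4 → ℝ) (j : Fin 4) : dot4 x (unit4 j) = x j := by
  fin_cases j <;> simp [dot4, unit4]

theorem dot4_self_nonneg (u : Fin 4 → ℝ) : 0 ≤ dot4 u u := by
  have := mul_self_nonneg (u 0)
  have := mul_self_nonneg (u 1)
  have := mul_self_nonneg (u 2)
  have := mul_self_nonneg (u 3)
  simp only [dot4]
  linarith

theorem eq_zero_of_dot4_self {u : Fin 4 → ℝ} (h : dot4 u u = 0) : u = 0 := by
  simp only [dot4] at h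
  have := mul_self_nonneg (u 0)
  have := mul_self_nonneg (u 1)
  have := mul_self_nonneg (u 2)
  have := mul_self_nonneg (u 3)
  ext i
  refine mul_self_eq_zero.1 ?_
  fin_cases i <;> simp <;> nlinarith

theorem normalize4_eq_smul (u : Fin 4 → ℝ) :
    normalize4 Real.sqrt u = (Real.sqrt (dot4 u u))⁻¹ • u := by
  ext i
  simp [normalize4, div_eq_inv_mul]

/-- A normalized vector has length one unless it vanishes. -/
theorem normalize4_spec (u : Fin 4 → ℝ) :
    (dot4 (normalize4 Real.sqrt u) (normalize4 Real.sqrt u) = 1 ∨ normalize4 Real.sqrt u = 0) ∧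
      u = Real.sqrt (dot4 u u) • normalize4 Real.sqrt u := by
  rw [normalize4_eq_smul]
  have h0 := dot4_self_nonneg u
  rcases h0.eq_or_lt with h | h
  · simp [eq_zero_of_dot4_self h.symm]
  · have hs := (Real.sqrt_pos.2 h).ne'
    refine ⟨Or.inl ?_, (smul_inv_smul₀ hs u).symm⟩
    rw [dot4_smul, dot4_comm (_ • u), dot4_smul, ← mul_assoc, ← mul_inv, Real.mul_self_sqrt h0,
      inv_mul_cancel₀ h.ne']

theorem dot4_normalize4 {x u : Fin 4 → ℝ} (h : dot4 x u = 0) :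
    dot4 x (normalize4 Real.sqrt u) = 0 := by
  rw [normalize4_eq_smul, dot4_smul, h, mul_zero]

theorem dot4_reject4_self {q : Fin 4 → ℝ} (hq : dot4 q q = 1 ∨ q = 0) (u : Fin 4 → ℝ) :
    dot4 q (reject4 q u) = 0 := by
  rw [dot4_reject4]
  rcases hq with h | rfl
  · rw [h]; ring
  · simp [dot4]

theorem firstNonzero4_spec {p : Fin 4 → Fin 4 → ℝ} (h : ∃ j, p j j ≠ 0) :
    ∃ j, firstNonzero4 p = p j ∧ p j j ≠ 0 := by
  by_cases h0 : p 0 0 = 0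
  · by_cases h1 : p 1 1 = 0
    · by_cases h2 : p 2 2 = 0
      · refine ⟨3, by ext i; simp [firstNonzero4, zeroIndicator_zero, h0, h1, h2], ?_⟩
        obtain ⟨j, hj⟩ := h
        fin_cases j
        exacts [absurd h0 hj, absurd h1 hj, absurd h2 hj, hj]
      · exact ⟨2, by ext i; simp [firstNonzero4, zeroIndicator_zero, h0, h1,
          zeroIndicator_of_ne_zero h2, h2], h2⟩
    · exact ⟨1, by ext i; simp [firstNonzero4, zeroIndicator_zero, h0,
        zeroIndicator_of_ne_zero h1, h1], h1⟩
  · exact ⟨0, by ext i; simp [firstNonzero4, zeroIndicator_of_ne_zero h0, h0], h0⟩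

/-- The null vector is nonzero, because the trace of the orthogonal projection onto the complement
of the span of three vectors in `ℝ⁴` is at least one. -/
theorem nullVec_spec (r : Fin 3 → Fin 4 → ℝ) :
    nullVec Real.sqrt r ≠ 0 ∧ ∀ l, dot4 (r l) (nullVec Real.sqrt r) = 0 := by
  set q := gramSchmidt4 Real.sqrt r with hq
  have h0 := normalize4_spec (r 0)
  have h1 := normalize4_spec (reject4 (q 0) (r 1))
  have h2 := normalize4_spec (reject4 (q 1) (reject4 (q 0) (r 2)))
  change (dot4 (q 0) (q 0) = 1 ∨ q 0 = 0) ∧ r 0 = _ • q 0 at h0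
  change (dot4 (q 1) (q 1) = 1 ∨ q 1 = 0) ∧ _ = _ • q 1 at h1
  change (dot4 (q 2) (q 2) = 1 ∨ q 2 = 0) ∧ _ = _ • q 2 at h2
  have h01 : dot4 (q 0) (q 1) = 0 := dot4_normalize4 (dot4_reject4_self h0.1 _)
  have h12 : dot4 (q 1) (q 2) = 0 := dot4_normalize4 (dot4_reject4_self h1.1 _)
  have h02 : dot4 (q 0) (q 2) = 0 := dot4_normalize4 (by
    change dot4 (q 0) (reject4 (q 1) (reject4 (q 0) (r 2))) = 0
    rw [dot4_reject4, dot4_reject4_self h0.1, h01]; ring)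
  have hlen : ∀ l, dot4 (q l) (q l) ≤ 1 := by
    have : ∀ x : Fin 4 → ℝ, (dot4 x x = 1 ∨ x = 0) → dot4 x x ≤ 1 := by
      rintro x (h | rfl)
      · exact h.le
      · simp [dot4]
    intro l
    fin_cases l
    exacts [this _ h0.1, this _ h1.1, this _ h2.1]
  have hq0 : ∀ j, dot4 (q 0) (rejectUnit4 q j) = 0 := fun j => by
    rw [rejectUnit4, dot4_reject4, dot4_reject4, dot4_reject4_self h0.1, h01, h02]; ring
  have hq1 : ∀ j, dot4 (q 1) (rejectUnit4 q j) = 0 := fun j => by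
    rw [rejectUnit4, dot4_reject4, dot4_reject4_self h1.1, h12]; ring
  have hq2 : ∀ j, dot4 (q 2) (rejectUnit4 q j) = 0 := fun j => dot4_reject4_self h2.1 _
  have hdiag : ∀ j, rejectUnit4 q j j = 1 - q 0 j * q 0 j - q 1 j * q 1 j - q 2 j * q 2 j := by
    intro j
    have e1 : dot4 (q 1) (reject4 (q 0) (unit4 j)) = q 1 j := by
      rw [dot4_reject4, dot4_unit4, dot4_comm (q 1) (q 0), h01]; ring
    have e2 : dot4 (q 2) (reject4 (q 1) (reject4 (q 0) (unit4 j))) = q 2 j := by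
      rw [dot4_reject4, dot4_reject4, dot4_unit4, dot4_comm (q 2) (q 0), h02,
        dot4_comm (q 2) (q 1), h12]
      ring
    rw [rejectUnit4, reject4, e2, reject4, e1, reject4, dot4_unit4]
    simp [unit4]
  -- the diagonal entries sum up to `4 - ∑ |q l| ^ 2 ≥ 1`
  have hex : ∃ j, rejectUnit4 q j j ≠ 0 := by
    by_contra! hcon
    have e0 := hdiag 0
    have e1 := hdiag 1
    have e2 := hdiag 2
    have e3 := hdiag 3
    rw [hcon] at e0 e1 e2 e3
    have f0 := hlen 0
    have f1 := hlen 1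
    have f2 := hlen 2
    simp only [dot4] at f0 f1 f2
    linarith
  obtain ⟨j, hj, hne⟩ := firstNonzero4_spec hex
  have hn : nullVec Real.sqrt r = rejectUnit4 q j := hj
  rw [hn]
  refine ⟨fun h => hne (by rw [h]; rfl), ?_⟩
  have key : ∀ (c : ℝ) (x y : Fin 4 → ℝ), dot4 x y = 0 → dot4 (c • x) y = 0 := by
    intro c x y h
    rw [dot4_comm, dot4_smul, dot4_comm, h, mul_zero]
  have rej : ∀ x y z : Fin 4 → ℝ, dot4 (reject4 x y) z = dot4 y z - dot4 x y * dot4 x z := by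
    intro x y z
    rw [dot4_comm, dot4_reject4, dot4_comm z, dot4_comm z]
  intro l
  fin_cases l
  · change dot4 (r 0) _ = 0
    rw [h0.2]
    exact key _ _ _ (hq0 j)
  · change dot4 (r 1) _ = 0
    have h := key √(dot4 (reject4 (q 0) (r 1)) (reject4 (q 0) (r 1))) _ _ (hq1 j)
    rw [← h1.2, rej, hq0] at h
    linarith
  · change dot4 (r 2) _ = 0
    have h := key √(dot4 (reject4 (q 1) (reject4 (q 0) (r 2)))
      (reject4 (q 1) (reject4 (q 0) (r 2)))) _ _ (hq2 j)
    rw [← h2.2, rej, rej, hq0, hq1] at h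
    linarith

theorem orient4_spec (d : Fin 4 → ℝ) :
    0 ≤ orient4 Real.sqrt d 0 + orient4 Real.sqrt d 1 ∧
      ∃ c : ℝ, c ≠ 0 ∧ orient4 Real.sqrt d = c • d := by
  have hc : ∀ i, orient4 Real.sqrt d i =
    ((d 0 + d 1) / |d 0 + d 1| + zeroIndicator (d 0 + d 1)) * d i := fun i => by
      rw [orient4, Real.sqrt_mul_self_eq_abs]
  rcases lt_trichotomy (d 0 + d 1) 0 with h | h | h
  · have e : (d 0 + d 1) / |d 0 + d 1| + zeroIndicator (d 0 + d 1) = -1 := by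
      rw [abs_of_neg h, zeroIndicator_of_ne_zero h.ne, div_neg, div_self h.ne, add_zero]
    rw [e] at hc
    exact ⟨by rw [hc, hc]; linarith, -1, by norm_num, by ext i; rw [hc]; simp⟩
  · have e : (d 0 + d 1) / |d 0 + d 1| + zeroIndicator (d 0 + d 1) = 1 := by
      rw [h, zeroIndicator_zero]; simp
    rw [e] at hc
    exact ⟨by rw [hc, hc]; linarith, 1, by norm_num, by ext i; rw [hc]; simp⟩
  · have e : (d 0 + d 1) / |d 0 + d 1| + zeroIndicator (d 0 + d 1) = 1 := by
      rw [abs_of_pos h, zeroIndicator_of_ne_zero h.ne', div_self h.ne', add_zero]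
    rw [e] at hc
    exact ⟨by rw [hc, hc]; linarith, 1, by norm_num, by ext i; rw [hc]; simp⟩

theorem topEigenvalue_spec {d : Fin 4 → ℝ} (hd : d ≠ 0) (h : 0 ≤ d 0 + d 1) :
    0 < topEigenvalue Real.sqrt d ∧ d 0 ≤ topEigenvalue Real.sqrt d ∧
      d 1 ≤ topEigenvalue Real.sqrt d ∧
      (topEigenvalue Real.sqrt d - d 0) * (topEigenvalue Real.sqrt d - d 1)
        = d 2 ^ 2 + d 3 ^ 2 := by
  unfold topEigenvalue
  have m0 := mul_self_nonneg (d 0 - d 1)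
  have m2 := mul_self_nonneg (d 2)
  have m3 := mul_self_nonneg (d 3)
  generalize hD : (d 0 - d 1) * (d 0 - d 1) + (1 + 1) * (1 + 1) * (d 2 * d 2 + d 3 * d 3) = D
  have hD0 : 0 ≤ D := by linarith
  have hsq := Real.mul_self_sqrt hD0
  have hs0 := Real.sqrt_nonneg D
  have habs : |d 0 - d 1| ≤ Real.sqrt D := Real.abs_le_sqrt (by nlinarith)
  obtain ⟨hb1, hb2⟩ := abs_le.1 habs
  generalize Real.sqrt D = s at hsq hs0 hb1 hb2 ⊢
  have hprod : ((d 0 + d 1 + s) / (1 + 1) - d 0) * ((d 0 + d 1 + s) / (1 + 1) - d 1)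
      = d 2 ^ 2 + d 3 ^ 2 := by
    linear_combination (1/4) * hsq - (1/4) * hD
  refine ⟨?_, by linarith, by linarith, hprod⟩
  refine lt_of_le_of_ne (by linarith) fun h0 => hd ?_
  have hs : s = 0 := by linarith
  have hx : d 0 + d 1 = 0 := by linarith
  rw [hs] at hb1 hb2
  have e0 : d 0 = 0 := by linarith
  have e1 : d 1 = 0 := by linarith
  rw [← h0, e0, e1] at hprod
  have e2 : d 2 = 0 := by nlinarith
  have e3 : d 3 = 0 := by nlinarith
  ext i
  fin_cases i <;> assumption

/-- The entries of `z zᴴ = 1 + t D`, where `t = -1 / l`. If `z 0 = 0`, the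
other entry is chosen to be real. -/
theorem rankOneFactor_spec {d : Fin 4 → ℝ} (hd : d ≠ 0) (h : 0 ≤ d 0 + d 1) :
    let z := rankOneFactor Real.sqrt d
    (z 0 = 0 → z 2 = 0) ∧ ∃ t : ℝ, z 0 ^ 2 = 1 + t * d 0 ∧ z 1 ^ 2 + z 2 ^ 2 = 1 + t * d 1 ∧
      z 0 * z 1 = t * d 2 ∧ z 0 * z 2 = t * d 3 := by
  obtain ⟨hl, hl0, hl1, hprod⟩ := topEigenvalue_spec hd h
  intro z
  have z0 : z 0 = Real.sqrt ((topEigenvalue Real.sqrt d - d 0) / topEigenvalue Real.sqrt d) := rfl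
  have z1 : z 1 = zeroIndicator (z 0) *
      Real.sqrt ((topEigenvalue Real.sqrt d - d 1) / topEigenvalue Real.sqrt d) -
        d 2 / (topEigenvalue Real.sqrt d * z 0) := rfl
  have z2 : z 2 = 0 - d 3 / (topEigenvalue Real.sqrt d * z 0) := rfl
  generalize topEigenvalue Real.sqrt d = l at *
  generalize z 0 = a at *
  have hasq : a ^ 2 = (l - d 0) / l := by
    rw [z0]; exact Real.sq_sqrt (div_nonneg (by linarith) hl.le)
  have hl' := hl.ne'
  by_cases h0 : a = 0
  · have hz : l - d 0 = 0 := by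
      rw [h0] at hasq; field_simp at hasq; linarith
    rw [hz, zero_mul] at hprod
    have e2 : d 2 = 0 := by nlinarith
    have e3 : d 3 = 0 := by nlinarith
    have hb := Real.sq_sqrt (show 0 ≤ (l - d 1) / l from div_nonneg (by linarith) hl.le)
    rw [h0, zeroIndicator_zero, e2] at z1
    rw [h0, e3] at z2
    simp only [mul_zero, div_zero, sub_zero, one_mul] at z1 z2
    refine ⟨fun _ => z2, -1 / l, ?_, ?_, ?_, ?_⟩
    · rw [hasq]; field_simp; ring
    · rw [z1, z2, hb]; field_simp; ring
    · rw [h0, e2]; ring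
    · rw [h0, e3]; ring
  · rw [zeroIndicator_of_ne_zero h0, zero_mul] at z1
    refine ⟨fun h => absurd h h0, -1 / l, ?_, ?_, ?_, ?_⟩
    · rw [hasq]; field_simp; ring
    · have e : z 1 ^ 2 + z 2 ^ 2 = (d 2 ^ 2 + d 3 ^ 2) / (l ^ 2 * a ^ 2) := by
        rw [z1, z2]; field_simp; ring
      have hne : l - d 0 ≠ 0 := fun h' => h0 (by simpa [h'] using hasq)
      rw [e, ← hprod, hasq]
      field_simp
      ring
    · rw [z1]; field_simp; ring
    · rw [z2]; field_simp; ring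

/-- The defining property of the coefficients: they preserve the sum of the first two entries of
each row. -/
theorem mergeCoeff_spec (r : Fin 3 → Fin 4 → ℝ) :
    let z := mergeCoeff Real.sqrt r
    (z 0 = 0 → z 2 = 0) ∧ ∀ l, z 0 ^ 2 * r l 0 + (z 1 ^ 2 + z 2 ^ 2) * r l 1 +
      z 0 * z 1 * r l 2 + z 0 * z 2 * r l 3 = r l 0 + r l 1 := by
  intro z
  obtain ⟨hne, horth⟩ := nullVec_spec r
  obtain ⟨hsum, c, hc, hcd⟩ := orient4_spec (nullVec Real.sqrt r)
  have hd : orient4 Real.sqrt (nullVec Real.sqrt r) ≠ 0 := by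
    rw [hcd]; exact smul_ne_zero hc hne
  obtain ⟨h0, t, e0, e1, e2, e3⟩ := rankOneFactor_spec hd hsum
  refine ⟨h0, fun l => ?_⟩
  have ho : dot4 (r l) (orient4 Real.sqrt (nullVec Real.sqrt r)) = 0 := by
    rw [hcd, dot4_smul, horth, mul_zero]
  change z 0 ^ 2 = _ at e0
  change z 1 ^ 2 + z 2 ^ 2 = _ at e1
  change z 0 * z 1 = _ at e2
  change z 0 * z 2 = _ at e3
  rw [e0, e1, e2, e3]
  simp only [dot4] at ho
  linear_combination t * ho

end RealStraightLine

/-! ### Quadratic forms, Cholesky steps and optimality of rank-one solutions -/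

section Matrices

open Matrix

variable {𝕜 : Type*} [RCLike 𝕜] {n : ℕ}

theorem matInner_vecMulVec (A : Matrix (Fin n) (Fin n) 𝕜) (x : Fin n → 𝕜) :
    matInner A (vecMulVec x (star x)) = quadForm A x := by
  rw [matInner, quadForm, conjTranspose_vecMulVec, star_star, vecMulVec_mul, trace_vecMulVec,
    dotProduct_comm, dotProduct_mulVec]

theorem matInner_sub (A X Y : Matrix (Fin n) (Fin n) 𝕜) :
    matInner A (X - Y) = matInner A X - matInner A Y := by
  simp [matInner, sub_mul]

theorem matInner_smul (c : ℝ) (A X : Matrix (Fin n) (Fin n) 𝕜) :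
    matInner A (c • X) = c * matInner A X := by
  simp [matInner, conjTranspose_smul, RCLike.smul_re]

theorem matInner_zero (A : Matrix (Fin n) (Fin n) 𝕜) : matInner A 0 = 0 := by
  simp [matInner]

theorem star_dotProduct_mulVec_swap {A : Matrix (Fin n) (Fin n) 𝕜} (hA : A.IsHermitian)
    (w v : Fin n → 𝕜) : star v ⬝ᵥ (A *ᵥ w) = star (star w ⬝ᵥ (A *ᵥ v)) := by
  rw [star_dotProduct, star_mulVec, hA.eq, dotProduct_mulVec]

/-- The quadratic form of a combination of two vectors. -/
theorem quadForm_smul_add_smul {A : Matrix (Fin n) (Fin n) 𝕜} (hA : A.IsHermitian)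
    (w v : Fin n → 𝕜) (a : ℝ) (b : 𝕜) :
    quadForm A ((a : 𝕜) • w + b • v) = a ^ 2 * quadForm A w +
      (RCLike.re b ^ 2 + RCLike.im b ^ 2) * quadForm A v +
      2 * a * (RCLike.re b * RCLike.re (star w ⬝ᵥ (A *ᵥ v)) -
        RCLike.im b * RCLike.im (star w ⬝ᵥ (A *ᵥ v))) := by
  have hq : RCLike.im (star v ⬝ᵥ (A *ᵥ v)) = 0 :=
    RCLike.conj_eq_iff_im.1 (star_dotProduct_mulVec_swap hA v v).symm
  simp only [quadForm, star_add, star_smul, mulVec_add, mulVec_smul, add_dotProduct,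
    dotProduct_add, smul_dotProduct, dotProduct_smul, smul_eq_mul,
    star_dotProduct_mulVec_swap hA w v]
  generalize star w ⬝ᵥ (A *ᵥ v) = h
  generalize star w ⬝ᵥ (A *ᵥ w) = p
  generalize star v ⬝ᵥ (A *ᵥ v) = q at hq ⊢
  simp [RCLike.mul_re, RCLike.mul_im, hq]
  ring

/-- One step of the Cholesky factorization: the column split off from `X`. -/
def cholColumn (X : Matrix (Fin n) (Fin n) 𝕜) (k : Fin n) : Fin n → 𝕜 := fun i =>
  X i k / (Real.sqrt (RCLike.re (X k k)) : 𝕜)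

/-- One step of the Cholesky factorization: the matrix that remains. -/
def cholRest (X : Matrix (Fin n) (Fin n) 𝕜) (k : Fin n) : Matrix (Fin n) (Fin n) 𝕜 :=
  X - vecMulVec (cholColumn X k) (star (cholColumn X k))

theorem Matrix.PosSemidef.apply_eq_zero {X : Matrix (Fin n) (Fin n) 𝕜} (hX : X.PosSemidef)
    {k : Fin n} (hk : X k k = 0) (i : Fin n) : X i k = 0 := by
  have h := (hX.dotProduct_mulVec_zero_iff (Pi.single k 1)).1 (by simp [hk])
  simpa using congrFun h i

theorem cholRest_apply {X : Matrix (Fin n) (Fin n) 𝕜} (hX : X.PosSemidef) (k i j : Fin n) :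
    cholRest X k i j = X i j - X i k * X k j / X k k := by
  have hkk : (RCLike.re (X k k) : 𝕜) = X k k := RCLike.conj_eq_iff_re.1 (hX.1.apply k k)
  have hsq : (Real.sqrt (RCLike.re (X k k)) : 𝕜) * (Real.sqrt (RCLike.re (X k k)) : 𝕜) =
      X k k := by
    rw [← RCLike.ofReal_mul,
      Real.mul_self_sqrt (RCLike.nonneg_iff.1 (hX.diag_nonneg (i := k))).1, hkk]
  have hsym : star (X j k) = X k j := hX.1.apply k j
  have hs : cholRest X k i j = X i j - X i k * star (X j k) /
      ((Real.sqrt (RCLike.re (X k k)) : 𝕜) * (Real.sqrt (RCLike.re (X k k)) : 𝕜)) := by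
    simp only [cholRest, cholColumn, Matrix.sub_apply, vecMulVec_apply, Pi.star_apply, star_div₀,
      RCLike.star_def, RCLike.conj_ofReal, div_mul_div_comm]
  rw [hs, hsq, hsym]

/-- The remainder is congruent to `X`, by an elimination matrix. -/
theorem cholRest_posSemidef {X : Matrix (Fin n) (Fin n) 𝕜} (hX : X.PosSemidef) (k : Fin n) :
    (cholRest X k).PosSemidef := by
  by_cases h0 : X k k = 0
  · have : cholRest X k = X := by
      ext i j
      rw [cholRest_apply hX, h0, div_zero, sub_zero]
    rwa [this]
  · have hsym : ∀ i, star (X k i) = X i k := fun i => hX.1.apply i k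
    set L : Matrix (Fin n) (Fin n) 𝕜 := 1 - vecMulVec (Pi.single k 1) (fun j => X k j / X k k)
    have : cholRest X k = Lᴴ * X * L := by
      have e1 : X * L = X - vecMulVec (fun i => X i k) (fun j => X k j / X k k) := by
        simp only [L, mul_sub, mul_one, mul_vecMulVec]
        congr 2
        ext i; simp
      have e2 : Lᴴ = 1 - vecMulVec (fun i => X i k / X k k) (Pi.single k 1) := by
        simp only [L, conjTranspose_sub, conjTranspose_one, conjTranspose_vecMulVec]
        congr 2
        · ext i
          rw [Pi.star_apply, star_div₀, hsym, hsym]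
        · ext i
          simp [Pi.single_apply, apply_ite]
      rw [mul_assoc, e1, e2, sub_mul, one_mul, vecMulVec_mul]
      ext i j
      rw [cholRest_apply hX]
      simp [vecMulVec_apply]
      field_simp
      simp
    rw [this]
    exact hX.conjTranspose_mul_mul_same L

theorem cholRest_apply_self {X : Matrix (Fin n) (Fin n) 𝕜} (hX : X.PosSemidef) (k i : Fin n) :
    cholRest X k i k = 0 := by
  rw [cholRest_apply hX]
  by_cases h0 : X k k = 0
  · rw [PosSemidef.apply_eq_zero hX h0 i]; simp
  · rw [mul_div_cancel_right₀ _ h0, sub_self]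

theorem cholRest_apply_eq_zero {X : Matrix (Fin n) (Fin n) 𝕜} (hX : X.PosSemidef) {k l : Fin n}
    (h : ∀ i, X i l = 0) (i : Fin n) : cholRest X k i l = 0 := by
  have : X l k = 0 := by rw [← hX.1.apply, h, star_zero]
  simp [cholRest, cholColumn, vecMulVec_apply, h, this]

/-- Up to a factor, `w wᴴ` is bounded by `X` in the order of Hermitian matrices. -/
def DominatedBy (w : Fin n → 𝕜) (X : Matrix (Fin n) (Fin n) 𝕜) : Prop :=
  ∃ C : ℝ, 0 ≤ C ∧ (C • X - vecMulVec w (star w)).PosSemidef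

theorem DominatedBy.zero (X : Matrix (Fin n) (Fin n) 𝕜) : DominatedBy 0 X :=
  ⟨0, le_rfl, by simpa using PosSemidef.zero⟩

theorem DominatedBy.combination {w v : Fin n → 𝕜} {X : Matrix (Fin n) (Fin n) 𝕜}
    (hw : DominatedBy w X) (hv : DominatedBy v X) (a b : 𝕜) : DominatedBy (a • w + b • v) X := by
  obtain ⟨C, hC, hCw⟩ := hw
  obtain ⟨D, hD, hDv⟩ := hv
  refine ⟨2 * ‖a‖ ^ 2 * C + 2 * ‖b‖ ^ 2 * D, by positivity, ?_⟩
  have h := ((hCw.smul (show (0 : ℝ) ≤ 2 * ‖a‖ ^ 2 by positivity)).add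
    (hDv.smul (show (0 : ℝ) ≤ 2 * ‖b‖ ^ 2 by positivity))).add
    (posSemidef_vecMulVec_self_star (a • w - b • v))
  convert h using 1
  ext i j
  have ha : (‖a‖ ^ 2 : 𝕜) = a * star a := (RCLike.mul_conj a).symm
  have hb : (‖b‖ ^ 2 : 𝕜) = b * star b := (RCLike.mul_conj b).symm
  simp only [Matrix.sub_apply, Matrix.add_apply, Matrix.smul_apply, vecMulVec_apply,
    Pi.star_apply, Pi.add_apply, Pi.sub_apply, Pi.smul_apply, smul_eq_mul, star_add, star_sub,
    star_mul', RCLike.real_smul_eq_coe_mul]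
  push_cast
  rw [ha, hb]
  ring

namespace HQP

variable {m : ℕ}

theorem Feasible.sdpFeasible {P : HQP 𝕜 n m} {y : Fin n → 𝕜} (hy : P.Feasible y) :
    P.SDPFeasible (vecMulVec y (star y)) :=
  ⟨posSemidef_vecMulVec_self_star y, fun i => by rw [matInner_vecMulVec]; exact hy i⟩

/-- A vector in the range of an optimal solution `X` of the relaxation that attains the same
values of the constraint forms attains the same value of the objective, because
`(1 + ε) X - ε w wᴴ` is feasible for small `ε > 0`. -/
theorem IsSDPOptimal.isOptimal_of_dominatedBy {P : HQP 𝕜 n m} {X : Matrix (Fin n) (Fin n) 𝕜}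
    (hX : P.IsSDPOptimal X) {w : Fin n → 𝕜} (hw : DominatedBy w X)
    (h : ∀ i, quadForm (P.A i) w = matInner (P.A i) X) :
    P.IsOptimal w ∧ quadForm P.A₀ w = matInner P.A₀ X := by
  obtain ⟨⟨hpsd, hfeas⟩, hopt⟩ := hX
  obtain ⟨C, hC, hCw⟩ := hw
  have hwf : P.Feasible w := fun i => by rw [h]; exact hfeas i
  have hle : matInner P.A₀ X ≤ quadForm P.A₀ w := by
    rw [← matInner_vecMulVec]; exact hopt _ hwf.sdpFeasible
  have hge : quadForm P.A₀ w ≤ matInner P.A₀ X := by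
    -- `ε = 1 / (1 + C)` is small enough, because `w wᴴ ≤ C X`
    have hε : (0 : ℝ) < 1 / (1 + C) := by positivity
    have hval : ∀ A : Matrix (Fin n) (Fin n) 𝕜,
        matInner A ((1 + 1 / (1 + C)) • X - (1 / (1 + C)) • vecMulVec w (star w)) =
        matInner A X + 1 / (1 + C) * (matInner A X - quadForm A w) := fun A => by
      rw [matInner_sub, matInner_smul, matInner_smul, matInner_vecMulVec]; ring
    have hp : ((1 + 1 / (1 + C)) • X - (1 / (1 + C)) • vecMulVec w (star w)).PosSemidef := by
      have h2 := (hpsd.smul (show (0 : ℝ) ≤ 1 + 1 / (1 + C) - 1 / (1 + C) * C by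
        have : 1 / (1 + C) * C ≤ 1 := by
          rw [one_div_mul_eq_div, div_le_one (by positivity)]; linarith
        linarith)).add (hCw.smul hε.le)
      convert h2 using 1
      rw [smul_sub, smul_smul, ← add_sub_assoc, ← add_smul]
      congr 2
      ring
    have h3 := hopt _ ⟨hp, fun i => by
      rw [hval, h, sub_self, mul_zero, add_zero]; exact hfeas i⟩
    rw [hval] at h3
    have : 0 ≤ matInner P.A₀ X - quadForm P.A₀ w :=
      nonneg_of_mul_nonneg_right (by linarith) hε
    linarith
  refine ⟨⟨hwf, fun y hy => ?_⟩, le_antisymm hge hle⟩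
  rw [← matInner_vecMulVec P.A₀ y]
  exact hge.trans (hopt _ hy.sdpFeasible)

end HQP

end Matrices

/-! ### Existence of an optimal solution of the relaxation -/

section Existence

open Matrix
open scoped MatrixOrder

variable {𝕜 : Type*} [RCLike 𝕜] {n m : ℕ}

theorem exists_eq_conjTranspose_mul_self {X : Matrix (Fin n) (Fin n) 𝕜} (hX : X.PosSemidef) :
    ∃ B : Matrix (Fin n) (Fin n) 𝕜, X = Bᴴ * B :=
  CStarAlgebra.nonneg_iff_eq_star_mul_self.1 hX.nonneg

theorem exists_isUnit_eq_conjTranspose_mul_self {Z : Matrix (Fin n) (Fin n) 𝕜} (hZ : Z.PosDef) :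
    ∃ S : Matrix (Fin n) (Fin n) 𝕜, IsUnit S ∧ Z = Sᴴ * S := by
  obtain ⟨S, hS, h⟩ := CStarAlgebra.isStrictlyPositive_iff_eq_star_mul_self.1
    (isStrictlyPositive_iff_posDef.2 hZ)
  exact ⟨S, hS, h⟩

theorem re_trace_conjTranspose_mul_self (B : Matrix (Fin n) (Fin n) 𝕜) :
    RCLike.re (Bᴴ * B).trace = ∑ j, ∑ i, ‖B i j‖ ^ 2 := by
  simp only [trace, diag_apply, mul_apply, conjTranspose_apply, map_sum]
  refine Finset.sum_congr rfl fun j _ => Finset.sum_congr rfl fun i _ => ?_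
  rw [RCLike.star_def, RCLike.conj_mul, ← RCLike.ofReal_pow, RCLike.ofReal_re]

theorem isCompact_setOf_norm_apply_le (K : ℝ) :
    IsCompact {B : Matrix (Fin n) (Fin n) 𝕜 | ∀ i j, ‖B i j‖ ≤ K} := by
  have h : IsCompact (X := Fin n → Fin n → 𝕜)
      (Set.univ.pi fun _ => Set.univ.pi fun _ => Metric.closedBall (0 : 𝕜) K) :=
    isCompact_univ_pi fun _ => isCompact_univ_pi fun _ => isCompact_closedBall 0 K
  have e : {B : Matrix (Fin n) (Fin n) 𝕜 | ∀ i j, ‖B i j‖ ≤ K} =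
      (Set.univ.pi fun _ => Set.univ.pi fun _ => Metric.closedBall (0 : 𝕜) K :
        Set (Fin n → Fin n → 𝕜)) :=
    Set.ext fun B => ⟨fun h i _ j _ => mem_closedBall_zero_iff.2 (h i j),
      fun h i j => mem_closedBall_zero_iff.1 (h i trivial j trivial)⟩
  rw [e]
  exact h

theorem continuous_matInner (A : Matrix (Fin n) (Fin n) 𝕜) : Continuous (matInner A) := by
  unfold matInner
  fun_prop

namespace HQP

theorem isClosed_setOf_holds (σ : Sense) (c : ℝ) : IsClosed {a : ℝ | σ.Holds a c} := by
  cases σ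
  · exact isClosed_Iic
  · exact isClosed_singleton

theorem matInner_dualMatrix (P : HQP 𝕜 n m) (ν : Fin m → ℝ) (X : Matrix (Fin n) (Fin n) 𝕜) :
    matInner (P.dualMatrix ν) X = matInner P.A₀ X + ∑ i, ν i * matInner (P.A i) X := by
  simp [matInner, dualMatrix, mul_add, Matrix.mul_sum, trace_sum, RCLike.smul_re]

/-- The inequality behind weak duality. -/
theorem SDPFeasible.matInner_dualMatrix_le {P : HQP 𝕜 n m} {X : Matrix (Fin n) (Fin n) 𝕜}
    (hX : P.SDPFeasible X) {ν : Fin m → ℝ} (hν : ∀ i, (P.sense i).StrictDualSign (ν i)) :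
    matInner (P.dualMatrix ν) X ≤ matInner P.A₀ X + ∑ i, ν i * P.c i := by
  rw [matInner_dualMatrix]
  refine add_le_add_right (Finset.sum_le_sum fun i _ => ?_) _
  have h1 := hX.2 i
  have h2 := hν i
  revert h1 h2
  cases P.sense i
  · exact fun h1 h2 => mul_le_mul_of_nonneg_left h1 (le_of_lt h2)
  · exact fun h1 _ => (congrArg (ν i * ·) h1).le

theorem PrimalSlater.exists_sdpFeasible {P : HQP 𝕜 n m} (h : P.PrimalSlater) :
    ∃ X, P.SDPFeasible X := by
  obtain ⟨X, hX, h⟩ := h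
  refine ⟨X, hX.posSemidef, fun i => ?_⟩
  have := h i
  revert this
  cases P.sense i
  · exact fun h => le_of_lt h
  · exact id

/-- The relaxation attains its minimum: a positive definite dual matrix `Sᴴ S` bounds the feasible
matrices `S⁻¹ Bᴴ B S⁻ᴴ` whose objective does not exceed that of a given feasible matrix. -/
theorem exists_isSDPOptimal {P : HQP 𝕜 n m} (hp : P.PrimalSlater) (hd : P.DualSlater) :
    ∃ X, P.IsSDPOptimal X := by
  obtain ⟨X₀, hX₀⟩ := hp.exists_sdpFeasible
  obtain ⟨ν, hZ, hν⟩ := hd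
  obtain ⟨S, hS, hZS⟩ := exists_isUnit_eq_conjTranspose_mul_self hZ
  have hdet : IsUnit S.det := (isUnit_iff_isUnit_det S).1 hS
  set f : Matrix (Fin n) (Fin n) 𝕜 → Matrix (Fin n) (Fin n) 𝕜 := fun B =>
    S⁻¹ * (Bᴴ * B) * S⁻¹ᴴ with hf
  have hfc : Continuous f := by fun_prop
  have hfp : ∀ B, (f B).PosSemidef := fun B =>
    (posSemidef_conjTranspose_mul_self B).mul_mul_conjTranspose_same _
  have hfs : ∀ X : Matrix (Fin n) (Fin n) 𝕜, X.PosSemidef → ∃ B, f B = X := fun X hX => by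
    obtain ⟨B, hB⟩ := exists_eq_conjTranspose_mul_self (hX.mul_mul_conjTranspose_same S)
    refine ⟨B, ?_⟩
    have h1 : Sᴴ * S⁻¹ᴴ = 1 := by
      rw [← conjTranspose_mul, nonsing_inv_mul _ hdet, conjTranspose_one]
    simp only [hf]
    rw [← hB, mul_assoc, mul_assoc, h1, mul_one, ← mul_assoc, nonsing_inv_mul _ hdet, one_mul]
  have hfz : ∀ B, matInner (P.dualMatrix ν) (f B) = ∑ j, ∑ i, ‖B i j‖ ^ 2 := fun B => by
    have h1 : S⁻¹ᴴ * Sᴴ = 1 := by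
      rw [← conjTranspose_mul, mul_nonsing_inv _ hdet, conjTranspose_one]
    rw [← re_trace_conjTranspose_mul_self, matInner, (hfp B).1.eq, hZS]
    congr 1
    calc (f B * (Sᴴ * S)).trace = (S⁻¹ * (Bᴴ * B) * (S⁻¹ᴴ * Sᴴ) * S).trace := by
          simp only [hf, mul_assoc]
      _ = (S * S⁻¹ * (Bᴴ * B)).trace := by
          rw [h1, mul_one, trace_mul_comm, mul_assoc]
      _ = _ := by rw [mul_nonsing_inv _ hdet, one_mul]
  set s : Set (Matrix (Fin n) (Fin n) 𝕜) :=
    {B | (∀ i, (P.sense i).Holds (matInner (P.A i) (f B)) (P.c i)) ∧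
      matInner P.A₀ (f B) ≤ matInner P.A₀ X₀} with hs
  have hclosed : IsClosed s := by
    have e : s = (⋂ i, f ⁻¹' (matInner (P.A i) ⁻¹' {a | (P.sense i).Holds a (P.c i)})) ∩
        {B | matInner P.A₀ (f B) ≤ matInner P.A₀ X₀} := by
      ext B; simp [hs]
    rw [e]
    refine IsClosed.inter ?_ ?_
    · exact isClosed_iInter fun i => ((isClosed_setOf_holds _ _).preimage
        (continuous_matInner (P.A i))).preimage hfc
    · exact isClosed_le ((continuous_matInner P.A₀).comp hfc) continuous_const
  have hbdd : s ⊆ {B | ∀ i j, ‖B i j‖ ≤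
      Real.sqrt (matInner P.A₀ X₀ + ∑ i, ν i * P.c i)} := by
    intro B hB i j
    refine Real.le_sqrt_of_sq_le ?_
    have h1 := SDPFeasible.matInner_dualMatrix_le ⟨hfp B, hB.1⟩ hν
    rw [hfz] at h1
    have h2 : ‖B i j‖ ^ 2 ≤ ∑ j, ∑ i, ‖B i j‖ ^ 2 :=
      (Finset.single_le_sum (f := fun i => ‖B i j‖ ^ 2) (fun i _ => by positivity)
        (Finset.mem_univ i)).trans
      (Finset.single_le_sum (f := fun j => ∑ i, ‖B i j‖ ^ 2)
        (fun j _ => Finset.sum_nonneg fun i _ => by positivity) (Finset.mem_univ j))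
    have h3 := hB.2
    linarith
  have hcomp : IsCompact s := (isCompact_setOf_norm_apply_le _).of_isClosed_subset hclosed hbdd
  have hmem : ∀ X, P.SDPFeasible X → matInner P.A₀ X ≤ matInner P.A₀ X₀ →
      ∃ B ∈ s, f B = X := fun X hX hle => by
    obtain ⟨B, rfl⟩ := hfs X hX.1
    exact ⟨B, ⟨hX.2, hle⟩, rfl⟩
  obtain ⟨B₀, hB₀, -⟩ := hmem X₀ hX₀ le_rfl
  obtain ⟨B, hB, hmin⟩ := hcomp.exists_isMinOn ⟨B₀, hB₀⟩
    ((continuous_matInner P.A₀).comp hfc).continuousOn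
  refine ⟨f B, ⟨hfp B, hB.1⟩, fun Y hY => ?_⟩
  rcases le_total (matInner P.A₀ Y) (matInner P.A₀ X₀) with h | h
  · obtain ⟨C, hC, rfl⟩ := hmem Y hY h
    exact hmin hC
  · exact hB.2.trans h

theorem value_eq_of_isOptimal {P : HQP 𝕜 n m} {x : Fin n → 𝕜} (hx : P.IsOptimal x) :
    P.value = ((quadForm P.A₀ x : ℝ) : EReal) :=
  le_antisymm (iInf₂_le x hx.1) (le_iInf₂ fun y hy => EReal.coe_le_coe_iff.2 (hx.2 y hy))

theorem sdpValue_eq_of_isSDPOptimal {P : HQP 𝕜 n m} {X : Matrix (Fin n) (Fin n) 𝕜}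
    (hX : P.IsSDPOptimal X) : P.sdpValue = ((matInner P.A₀ X : ℝ) : EReal) :=
  le_antisymm (iInf₂_le X hX.1) (le_iInf₂ fun Y hY => EReal.coe_le_coe_iff.2 (hX.2 Y hY))

end HQP

end Existence

/-! ### Merging two vectors -/

section Merge

open Matrix

/-- The rows of the linear system of the merging step: one row for each of the `d + 1` forms and,
for `d = 1`, the condition that the imaginary part of the off-diagonal entry vanishes. -/
def mergeRows {α : Type*} [Zero α] [One α] (d : ℕ) (F : Fin 3 → Fin 4 → α) : Fin 3 → Fin 4 → α :=
  fun l => if l.val < d + 1 then F l else unit4 3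

variable {𝕜 : Type*} [RCLike 𝕜] {n : ℕ}

theorem fieldDim_le_two : fieldDim 𝕜 ≤ 2 := RCLike.finrank_le_two 𝕜

theorem fieldDim_of_I_eq_zero (h : (RCLike.I : 𝕜) = 0) : fieldDim 𝕜 = 1 :=
  finrank_eq_one (1 : 𝕜) one_ne_zero fun z => ⟨RCLike.re z, by
    rw [RCLike.real_smul_eq_coe_mul, mul_one]
    conv_rhs => rw [← RCLike.re_add_im z, h, mul_zero, add_zero]⟩

/-- The coefficients of the form of `A` on the combinations of `w` and `v`. -/
def formRow (A : Matrix (Fin n) (Fin n) 𝕜) (w v : Fin n → 𝕜) : Fin 4 → ℝ :=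
  ![quadForm A w, quadForm A v, 2 * RCLike.re (star w ⬝ᵥ (A *ᵥ v)),
    -(2 * RCLike.im (star w ⬝ᵥ (A *ᵥ v)))]

/-- The scalar with given real and imaginary parts. -/
def ofParts (x y : ℝ) : 𝕜 := (x : 𝕜) + (y : 𝕜) * RCLike.I

/-- The combination of `w` and `v` with coefficients `z 0` and `z 1 + z 2 I`. -/
def combine (z : Fin 3 → ℝ) (w v : Fin n → 𝕜) : Fin n → 𝕜 :=
  (z 0 : 𝕜) • w + (ofParts (z 1) (z 2) : 𝕜) • v

theorem re_ofParts (x y : ℝ) : RCLike.re (ofParts x y : 𝕜) = x := by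
  simp [ofParts, RCLike.mul_re]

/-- If the field is `ℝ`, the last row of the linear system makes the imaginary part vanish. -/
theorem im_ofParts_mergeCoeff (F : Fin 3 → Fin 4 → ℝ) :
    let z := mergeCoeff Real.sqrt (mergeRows (fieldDim 𝕜) F)
    RCLike.im (ofParts (z 1) (z 2) : 𝕜) = z 2 := by
  intro z
  rcases RCLike.I_eq_zero_or_im_I_eq_one (K := 𝕜) with h | h
  · obtain ⟨h0, hrow⟩ := mergeCoeff_spec (mergeRows (fieldDim 𝕜) F)
    have h2 := hrow 2
    rw [fieldDim_of_I_eq_zero h] at h2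
    have hz : z 0 * z 2 = 0 := by
      simpa [z, mergeRows, unit4, fieldDim_of_I_eq_zero h] using h2
    have : z 2 = 0 := by
      rcases mul_eq_zero.1 hz with hz | hz
      · exact h0 hz
      · exact hz
    simp [ofParts, this]
  · simp [ofParts, RCLike.mul_im, h]

/-- Merging preserves the sum of the values of each of the forms. -/
theorem quadForm_combine {A : Matrix (Fin n) (Fin n) 𝕜} (hA : A.IsHermitian) {w v : Fin n → 𝕜}
    {F : Fin 3 → Fin 4 → ℝ} {l : Fin 3} (hl : l.val < fieldDim 𝕜 + 1)
    (hF : F l = formRow A w v) :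
    quadForm A (combine (mergeCoeff Real.sqrt (mergeRows (fieldDim 𝕜) F)) w v) =
      quadForm A w + quadForm A v := by
  have him := im_ofParts_mergeCoeff (𝕜 := 𝕜) F
  obtain ⟨-, hrow⟩ := mergeCoeff_spec (mergeRows (fieldDim 𝕜) F)
  have h := hrow l
  have hr : mergeRows (fieldDim 𝕜) F l = formRow A w v := by
    rw [mergeRows, if_pos hl, hF]
  rw [hr] at h
  generalize mergeCoeff Real.sqrt (mergeRows (fieldDim 𝕜) F) = z at *
  rw [combine, quadForm_smul_add_smul hA, re_ofParts, him]
  simp only [formRow, cons_val_zero, cons_val_one, cons_val] at h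
  linear_combination h

end Merge

namespace RealRAM

/-! ### Reasoning about programs -/

/-- The memory of a state: the contents of all arrays. -/
abbrev Mem := ℕ → ℕ → ℕ → ℝ

/-- A bound for the running time, as a polynomial in the content of register `0`, for programs
whose loops are all repeated as many times as register `0` says. -/
def timeBound : Program → Polynomial ℕ
  | .skip => 1
  | .setIdx _ e => Polynomial.C (e.cost + 1)
  | .setCell _ i j e => Polynomial.C (i.cost + j.cost + e.cost + 1)
  | .seq p q => timeBound p + timeBound q
  | .branch b p q => Polynomial.C b.cost + timeBound p + timeBound q
  | .loop b p => Polynomial.X * (Polynomial.C b.cost + timeBound p) + Polynomial.C b.cost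

/-- A Hoare triple with a time bound: started with the values `ρ` in the registers below `R` and a
memory that satisfies `Pre`, the program halts within the time bound, with the same values in these
registers and a memory that satisfies `Post`. -/
def Triple (R : ℕ) (ρ : ℕ → ℕ) (Pre : Mem → Prop) (p : Program) (Post : Mem → Prop) : Prop :=
  ∀ s : State, (∀ r < R, s.idx r = ρ r) → Pre s.mem →
    ∃ t s', Runs p s t s' ∧ t ≤ (timeBound p).eval (ρ 0) ∧ (∀ r < R, s'.idx r = ρ r) ∧ Post s'.mem

variable {R : ℕ} {ρ : ℕ → ℕ} {Pre Mid Post : Mem → Prop} {p q : Program}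

theorem Triple.seq (hp : Triple R ρ Pre p Mid) (hq : Triple R ρ Mid q Post) :
    Triple R ρ Pre (.seq p q) Post := by
  intro s hs hpre
  obtain ⟨t, s', h1, ht, hs', hm⟩ := hp s hs hpre
  obtain ⟨t', s'', h2, ht', hs'', hm'⟩ := hq s' hs' hm
  exact ⟨_, _, .seq h1 h2, by simpa [timeBound] using add_le_add ht ht', hs'', hm'⟩

theorem Triple.mono {Pre' Post' : Mem → Prop} (h : Triple R ρ Pre p Post)
    (hpre : ∀ M, Pre' M → Pre M) (hpost : ∀ M, Post M → Post' M) : Triple R ρ Pre' p Post' := by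
  intro s hs hp
  obtain ⟨t, s', h1, h2, h3, h4⟩ := h s hs (hpre _ hp)
  exact ⟨t, s', h1, h2, h3, hpost _ h4⟩

/-- A precondition may be fixed to a particular memory. -/
theorem Triple.of_forall_mem (h : ∀ M, Pre M → Triple R ρ (· = M) p Post) :
    Triple R ρ Pre p Post :=
  fun s hs hp => h s.mem hp s hs rfl

theorem Triple.skip : Triple R ρ Pre .skip Pre :=
  fun s hs hp => ⟨1, s, .skip s, by simp [timeBound], hs, hp⟩

theorem Triple.setCell {a : ℕ} {i j : IdxExpr} {e : RealExpr}
    (h : ∀ s : State, (∀ r < R, s.idx r = ρ r) → Pre s.mem →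
      Post (s.writeCell a (i.eval s) (j.eval s) (e.eval s)).mem) :
    Triple R ρ Pre (.setCell a i j e) Post :=
  fun s hs hp => ⟨_, _, .setCell s a i j e, by simp [timeBound], hs, h s hs hp⟩

/-- The loop `for r = 0, …, n - 1 do p`, where `n` is the content of register `0`. -/
def forLoop (r : ℕ) (p : Program) : Program :=
  .seq (.setIdx r (.const 0)) (.loop (.idxLt (.reg r) (.reg 0))
    (.seq p (.setIdx r (.add (.reg r) (.const 1)))))

theorem Triple.forLoop {r : ℕ} (hr : 0 < r) {I : ℕ → Mem → Prop}
    (h : ∀ k < ρ 0, Triple (r + 1) (Function.update ρ r k) (I k) p (I (k + 1))) :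
    Triple r ρ (I 0) (forLoop r p) (I (ρ 0)) := by
  set tb := (timeBound p).eval (ρ 0) with htb
  have hloop : ∀ m k : ℕ, k + m = ρ 0 → ∀ s : State, (∀ r' < r, s.idx r' = ρ r') → s.idx r = k →
      I k s.mem → ∃ t s', Runs (.loop (.idxLt (.reg r) (.reg 0))
        (.seq p (.setIdx r (.add (.reg r) (.const 1))))) s t s' ∧ t ≤ m * (3 + (tb + 4)) + 3 ∧
        (∀ r' < r, s'.idx r' = ρ r') ∧ I (ρ 0) s'.mem := by
    intro m
    induction m with
    | zero =>
      intro k hk s hs hsr hI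
      have hk : k = ρ 0 := by omega
      subst hk
      refine ⟨_, s, .loopFalse ?_, ?_, hs, hI⟩
      · simp [Test.Holds, IdxExpr.eval, hsr, hs 0 hr]
      · simp [Test.cost, IdxExpr.cost]
    | succ m ih =>
      intro k hk s hs hsr hI
      obtain ⟨t, s', h1, ht, hs', hI'⟩ := h k (by omega) s (fun r' hr' => by
        rcases Nat.lt_succ_iff_lt_or_eq.1 hr' with hlt | rfl
        · rw [Function.update_of_ne hlt.ne, hs r' hlt]
        · rw [Function.update_self, hsr]) hI
      have hsr' : s'.idx r = k := by rw [hs' r (by omega), Function.update_self]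
      have hs0 : ∀ r' < r, s'.idx r' = ρ r' := fun r' hr' => by
        rw [hs' r' (by omega), Function.update_of_ne hr'.ne]
      obtain ⟨t', s'', h2, ht', hs'', hI''⟩ := ih (k + 1) (by omega)
        (s'.writeIdx r (IdxExpr.eval s' (.add (.reg r) (.const 1))))
        (fun r' hr' => by
          simp only [State.writeIdx, Function.update_of_ne hr'.ne]
          exact hs0 r' hr')
        (by simp [State.writeIdx, IdxExpr.eval, hsr']) hI'
      refine ⟨_, s'', .loopTrue ?_ (.seq h1 (.setIdx _ _ _)) h2, ?_, hs'', hI''⟩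
      · simp only [Test.Holds, IdxExpr.eval, hsr, hs 0 hr]; omega
      · rw [Function.update_of_ne hr.ne] at ht
        simp only [Test.cost, IdxExpr.cost]
        rw [add_mul, one_mul]
        omega
  intro s hs hI
  obtain ⟨t, s', h1, ht, hs', hI'⟩ := hloop (ρ 0) 0 (by omega)
    (s.writeIdx r (IdxExpr.eval s (.const 0)))
    (fun r' hr' => by
      simp only [State.writeIdx, Function.update_of_ne hr'.ne]
      exact hs r' hr')
    (by simp [State.writeIdx, IdxExpr.eval]) hI
  refine ⟨_, s', .seq (.setIdx _ _ _) h1, ?_, hs', hI'⟩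
  simp only [RealRAM.forLoop, timeBound, Polynomial.eval_add, Polynomial.eval_mul,
    Polynomial.eval_C, Polynomial.eval_X, IdxExpr.cost, Test.cost, ← htb]
  rw [show 1 + 1 + 1 + (tb + (1 + 1 + 1 + 1)) = 3 + (tb + 4) by omega]
  omega

/-! ### Loops that fill an array and loops that sum -/

/-- Fill column `c` of array `a`; the row index is in register `2`. -/
def fillColumn (a c : ℕ) (e : RealExpr) : Program :=
  forLoop 2 (.setCell a (.reg 2) (.const c) e)

/-- Fill array `a`; the row index is in register `2`, the column index in register `3`. -/
def fillMatrix (a : ℕ) (e : RealExpr) : Program :=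
  forLoop 2 (forLoop 3 (.setCell a (.reg 2) (.reg 3) e))

/-- Write into the cell `(c, c')` of array `a` the sum of `e` over all values of the registers `2`
and `3`. -/
def sumCell (a c c' : ℕ) (e : RealExpr) : Program :=
  .seq (.setCell a (.const c) (.const c') (.const 0))
    (forLoop 2 (forLoop 3 (.setCell a (.const c) (.const c')
      (.add (.cell a (.const c) (.const c')) e))))

theorem Triple.fillColumn {a c : ℕ} {e : RealExpr} {M : Mem} {val : ℕ → ℝ}
    (he : ∀ i < ρ 0, ∀ s : State, s.idx 0 = ρ 0 → s.idx 1 = ρ 1 → s.idx 2 = i →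
      s.mem a i c = M a i c → (∀ a' i' j', ¬ (a' = a ∧ j' = c) → s.mem a' i' j' = M a' i' j') →
      e.eval s = val i) :
    Triple 2 ρ (· = M) (fillColumn a c e) fun M' => (∀ i < ρ 0, M' a i c = val i) ∧
      ∀ a' i' j', ¬ (a' = a ∧ j' = c) → M' a' i' j' = M a' i' j' := by
  refine (Triple.forLoop (by norm_num) (I := fun k M' => (∀ i < k, M' a i c = val i) ∧
    (∀ i, k ≤ i → M' a i c = M a i c) ∧
      ∀ a' i' j', ¬ (a' = a ∧ j' = c) → M' a' i' j' = M a' i' j')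
    fun k hk => Triple.setCell ?_).mono ?_ ?_
  · rintro s hs ⟨h1, h2, h3⟩
    have r0 : s.idx 0 = ρ 0 := by simpa using hs 0 (by norm_num)
    have r1 : s.idx 1 = ρ 1 := by simpa using hs 1 (by norm_num)
    have r2 : s.idx 2 = k := by simpa using hs 2 (by norm_num)
    have hv := he k hk s r0 r1 r2 (h2 k le_rfl) h3
    simp only [State.writeCell, IdxExpr.eval, r2, hv, true_and, and_true]
    refine ⟨fun i hi => ?_, fun i hi => ?_, fun a' i' j' h => ?_⟩
    · split_ifs with h
      · rw [h]
      · exact h1 i (by omega)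
    · rw [if_neg (by omega), h2 i (by omega)]
    · rw [if_neg (by tauto), h3 a' i' j' h]
  · rintro _ rfl
    exact ⟨fun i hi => absurd hi (Nat.not_lt_zero i), fun _ _ => rfl, fun _ _ _ _ => rfl⟩
  · rintro M' ⟨h1, -, h3⟩
    exact ⟨h1, h3⟩

theorem Triple.fillMatrix {a : ℕ} {e : RealExpr} {M : Mem} {val : ℕ → ℕ → ℝ}
    (he : ∀ i < ρ 0, ∀ j < ρ 0, ∀ s : State, s.idx 0 = ρ 0 → s.idx 1 = ρ 1 → s.idx 2 = i →
      s.idx 3 = j → s.mem a i j = M a i j → (∀ a', a' ≠ a → s.mem a' = M a') → e.eval s = val i j) :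
    Triple 2 ρ (· = M) (fillMatrix a e) fun M' =>
      (∀ i < ρ 0, ∀ j < ρ 0, M' a i j = val i j) ∧ ∀ a', a' ≠ a → M' a' = M a' := by
  refine (Triple.forLoop (by norm_num) (I := fun k M' =>
    (∀ i < k, ∀ j < ρ 0, M' a i j = val i j) ∧ (∀ i, k ≤ i → ∀ j, M' a i j = M a i j) ∧
      ∀ a', a' ≠ a → M' a' = M a') fun k hk => ?_).mono ?_ ?_
  · refine (Triple.forLoop (by norm_num) (I := fun l M' =>
      (∀ i < k, ∀ j < ρ 0, M' a i j = val i j) ∧ (∀ j < l, M' a k j = val k j) ∧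
      (∀ j, l ≤ j → M' a k j = M a k j) ∧ (∀ i, k < i → ∀ j, M' a i j = M a i j) ∧
        ∀ a', a' ≠ a → M' a' = M a') fun l hl => Triple.setCell ?_).mono ?_ ?_
    · rintro s hs ⟨h1, h2, h3, h4, h5⟩
      rw [Function.update_of_ne (by norm_num)] at hl
      have r0 : s.idx 0 = ρ 0 := by simpa using hs 0 (by norm_num)
      have r1 : s.idx 1 = ρ 1 := by simpa using hs 1 (by norm_num)
      have r2 : s.idx 2 = k := by simpa using hs 2 (by norm_num)
      have r3 : s.idx 3 = l := by simpa using hs 3 (by norm_num)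
      have hv := he k hk l hl s r0 r1 r2 r3 (h3 l le_rfl) h5
      simp only [State.writeCell, IdxExpr.eval, r2, r3, hv, true_and]
      refine ⟨fun i hi j hj => ?_, fun j hj => ?_, fun j hj => ?_, fun i hi j => ?_,
        fun a' h => ?_⟩
      · rw [if_neg (by omega), h1 i hi j hj]
      · split_ifs with h
        · rw [h]
        · exact h2 j (by omega)
      · rw [if_neg (by omega), h3 j (by omega)]
      · rw [if_neg (by omega), h4 i hi]
      · funext i j
        rw [if_neg (by tauto), h5 a' h]
    · rintro M' ⟨h1, h2, h3⟩
      exact ⟨h1, fun j hj => absurd hj (Nat.not_lt_zero j), fun j _ => h2 k le_rfl j,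
        fun i hi => h2 i hi.le, h3⟩
    · rintro M' ⟨h1, h2, -, h4, h5⟩
      rw [Function.update_of_ne (by norm_num)] at h2
      refine ⟨fun i hi j hj => ?_, fun i hi => h4 i hi, h5⟩
      rcases Nat.lt_succ_iff_lt_or_eq.1 hi with h | rfl
      · exact h1 i h j hj
      · exact h2 j hj
  · rintro _ rfl
    exact ⟨fun i hi => absurd hi (Nat.not_lt_zero i), fun _ _ _ => rfl, fun _ _ => rfl⟩
  · rintro M' ⟨h1, -, h3⟩
    exact ⟨h1, h3⟩

theorem Triple.sumCell {a c c' : ℕ} {e : RealExpr} {M : Mem} {val : ℕ → ℕ → ℝ}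
    (he : ∀ i < ρ 0, ∀ j < ρ 0, ∀ s : State, s.idx 2 = i → s.idx 3 = j →
      (∀ a', a' ≠ a → s.mem a' = M a') → e.eval s = val i j) :
    Triple 2 ρ (· = M) (sumCell a c c' e) fun M' =>
      M' a c c' = ∑ i ∈ Finset.range (ρ 0), ∑ j ∈ Finset.range (ρ 0), val i j ∧
      ∀ a' i' j', ¬ (a' = a ∧ i' = c ∧ j' = c') → M' a' i' j' = M a' i' j' := by
  refine Triple.seq (Mid := fun M' => M' a c c' = 0 ∧
    ∀ a' i' j', ¬ (a' = a ∧ i' = c ∧ j' = c') → M' a' i' j' = M a' i' j') (Triple.setCell ?_) ?_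
  · rintro s hs rfl
    simp +contextual [State.writeCell, IdxExpr.eval, RealExpr.eval]
  refine (Triple.forLoop (by norm_num) (I := fun k M' =>
    M' a c c' = ∑ i ∈ Finset.range k, ∑ j ∈ Finset.range (ρ 0), val i j ∧
      ∀ a' i' j', ¬ (a' = a ∧ i' = c ∧ j' = c') → M' a' i' j' = M a' i' j')
    fun k hk => ?_).mono ?_ ?_
  · refine (Triple.forLoop (by norm_num) (I := fun l M' =>
      M' a c c' = ∑ i ∈ Finset.range k, ∑ j ∈ Finset.range (ρ 0), val i j +
        ∑ j ∈ Finset.range l, val k j ∧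
      ∀ a' i' j', ¬ (a' = a ∧ i' = c ∧ j' = c') → M' a' i' j' = M a' i' j')
      fun l hl => Triple.setCell ?_).mono ?_ ?_
    · rintro s hs ⟨h1, h2⟩
      rw [Function.update_of_ne (by norm_num)] at hl
      have r2 : s.idx 2 = k := by simpa using hs 2 (by norm_num)
      have r3 : s.idx 3 = l := by simpa using hs 3 (by norm_num)
      have hv := he k hk l hl s r2 r3 fun a' ha' => by
        funext i j
        exact h2 a' i j fun h => ha' h.1
      simp only [State.writeCell, IdxExpr.eval, RealExpr.eval, hv, and_self, if_true]
      refine ⟨by rw [h1, Finset.sum_range_succ, add_assoc], fun a' i' j' h => ?_⟩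
      rw [if_neg h, h2 a' i' j' h]
    · rintro M' ⟨h1, h2⟩
      exact ⟨by rw [h1]; simp, h2⟩
    · rintro M' ⟨h1, h2⟩
      rw [Function.update_of_ne (by norm_num)] at h1
      exact ⟨by rw [h1, Finset.sum_range_succ], h2⟩
  · rintro M' ⟨h1, h2⟩
    exact ⟨by rw [h1]; simp, h2⟩
  · exact fun _ h => h

end RealRAM

namespace RealRAM

/-! ### Arithmetic of real and of complex expressions -/

instance : Add RealExpr := ⟨.add⟩
instance : Sub RealExpr := ⟨.sub⟩
instance : Mul RealExpr := ⟨.mul⟩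
instance : Div RealExpr := ⟨.div⟩
instance : Zero RealExpr := ⟨.const 0⟩
instance : One RealExpr := ⟨.const 1⟩

section Eval

variable (s : State) (e f : RealExpr)

theorem eval_add : (e + f).eval s = e.eval s + f.eval s := rfl
theorem eval_sub : (e - f).eval s = e.eval s - f.eval s := rfl
theorem eval_mul : (e * f).eval s = e.eval s * f.eval s := rfl
theorem eval_div : (e / f).eval s = e.eval s / f.eval s := rfl
theorem eval_sqrt : (RealExpr.sqrt e).eval s = Real.sqrt (e.eval s) := rfl
theorem eval_zero : (0 : RealExpr).eval s = 0 := Rat.cast_zero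
theorem eval_one : (1 : RealExpr).eval s = 1 := Rat.cast_one

end Eval

/-- The values of a family of expressions. -/
def evalFamily {ι : Type*} (s : State) (u : ι → RealExpr) : ι → ℝ := fun i => (u i).eval s

section EvalStraightLine

variable (s : State)

theorem evalFamily_unit4 (j : Fin 4) : evalFamily s (unit4 j) = unit4 j := by
  funext i
  simp only [evalFamily, unit4]
  split_ifs
  · exact eval_one s
  · exact eval_zero s

theorem eval_zeroIndicator (e : RealExpr) :
    (zeroIndicator e).eval s = zeroIndicator (e.eval s) := by
  simp only [zeroIndicator, eval_sub, eval_div, eval_one]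

theorem evalFamily_reject4 (q u : Fin 4 → RealExpr) :
    evalFamily s (reject4 q u) = reject4 (evalFamily s q) (evalFamily s u) := rfl

theorem evalFamily_gramSchmidt4 (r : Fin 3 → Fin 4 → RealExpr) (l : Fin 3) :
    evalFamily s (gramSchmidt4 .sqrt r l) =
      gramSchmidt4 Real.sqrt (fun l => evalFamily s (r l)) l := by
  fin_cases l <;> rfl

theorem evalFamily_rejectUnit4 (q : Fin 3 → Fin 4 → RealExpr) (j : Fin 4) :
    evalFamily s (rejectUnit4 q j) = rejectUnit4 (fun l => evalFamily s (q l)) j := by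
  simp only [rejectUnit4, evalFamily_reject4, evalFamily_unit4]

theorem evalFamily_firstNonzero4 (p : Fin 4 → Fin 4 → RealExpr) :
    evalFamily s (firstNonzero4 p) = firstNonzero4 (fun j => evalFamily s (p j)) := by
  funext i
  simp only [evalFamily, firstNonzero4, eval_add, eval_mul, eval_div, eval_zeroIndicator]

theorem evalFamily_nullVec (r : Fin 3 → Fin 4 → RealExpr) :
    evalFamily s (nullVec .sqrt r) = nullVec Real.sqrt (fun l => evalFamily s (r l)) := by
  simp only [nullVec, evalFamily_firstNonzero4, evalFamily_rejectUnit4, evalFamily_gramSchmidt4]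

theorem evalFamily_orient4 (d : Fin 4 → RealExpr) :
    evalFamily s (orient4 .sqrt d) = orient4 Real.sqrt (evalFamily s d) := by
  funext i
  simp only [evalFamily, orient4, eval_add, eval_mul, eval_div, eval_sqrt, eval_zeroIndicator]

theorem eval_topEigenvalue (d : Fin 4 → RealExpr) :
    (topEigenvalue .sqrt d).eval s = topEigenvalue Real.sqrt (evalFamily s d) := by
  simp only [topEigenvalue, evalFamily, eval_add, eval_sub, eval_mul, eval_div, eval_sqrt,
    eval_one]

theorem evalFamily_rankOneFactor (d : Fin 4 → RealExpr) :
    evalFamily s (rankOneFactor .sqrt d) = rankOneFactor Real.sqrt (evalFamily s d) := by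
  funext q
  rw [rankOneFactor, rankOneFactor, ← eval_topEigenvalue]
  generalize topEigenvalue RealExpr.sqrt d = l
  fin_cases q
  · rfl
  · simp [evalFamily, eval_sub, eval_mul, eval_div, eval_sqrt, eval_zeroIndicator]
  · simp [evalFamily, eval_sub, eval_mul, eval_div, eval_sqrt, eval_zero]

theorem evalFamily_mergeCoeff (r : Fin 3 → Fin 4 → RealExpr) :
    evalFamily s (mergeCoeff .sqrt r) = mergeCoeff Real.sqrt (fun l => evalFamily s (r l)) := by
  rw [mergeCoeff, evalFamily_rankOneFactor, evalFamily_orient4, evalFamily_nullVec, mergeCoeff]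

theorem evalFamily_mergeRows (d : ℕ) (F : Fin 3 → Fin 4 → RealExpr) (l : Fin 3) :
    evalFamily s (mergeRows d F l) = mergeRows d (fun l => evalFamily s (F l)) l := by
  simp only [mergeRows]
  split_ifs
  · rfl
  · exact evalFamily_unit4 s 3

end EvalStraightLine

/-- Multiplication of complex numbers, given by their real and imaginary parts. -/
def cmul {α : Type*} [Add α] [Sub α] [Mul α] (x y : α × α) : α × α :=
  (x.1 * y.1 - x.2 * y.2, x.1 * y.2 + x.2 * y.1)

/-- Conjugation of complex numbers, given by their real and imaginary parts. -/
def cconj {α : Type*} [Sub α] [Zero α] (x : α × α) : α × α := (x.1, 0 - x.2)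

/-- The values of a pair of expressions. -/
def evalPair (s : State) (x : RealExpr × RealExpr) : ℝ × ℝ := (x.1.eval s, x.2.eval s)

theorem evalPair_cmul (s : State) (x y : RealExpr × RealExpr) :
    evalPair s (cmul x y) = cmul (evalPair s x) (evalPair s y) := rfl

theorem evalPair_cconj (s : State) (x : RealExpr × RealExpr) :
    evalPair s (cconj x) = cconj (evalPair s x) := by
  simp only [evalPair, cconj, eval_sub, eval_zero]

section Parts

variable {𝕜 : Type*} [RCLike 𝕜]

/-- The real and the imaginary part of a scalar. -/
def parts (z : 𝕜) : ℝ × ℝ := (RCLike.re z, RCLike.im z)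

theorem cmul_parts (z w : 𝕜) : cmul (parts z) (parts w) = parts (z * w) := by
  simp [cmul, parts, RCLike.mul_re, RCLike.mul_im]

theorem cconj_parts (z : 𝕜) : cconj (parts z) = parts (star z) := by
  simp [cconj, parts]

end Parts

/-! ### The program -/

/-- The entry of the complex matrix in the arrays `a` (real parts) and `b` (imaginary parts) at the
indices in the registers `2` and `3`. -/
def matEntry (a b : ℕ) : RealExpr × RealExpr :=
  (.cell a (.reg 2) (.reg 3), .cell b (.reg 2) (.reg 3))

/-- The entry of the complex vector in the columns `0` and `1` of array `a` at the index in
register `r`. -/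
def vecEntry (a r : ℕ) : RealExpr × RealExpr :=
  (.cell a (.reg r) (.const 0), .cell a (.reg r) (.const 1))

/-- Compute in array `16` the Cholesky column of the matrix in the arrays `4` and `5` that belongs
to the index in register `1`. -/
def columnProg : Program :=
  .seq (fillColumn 16 0 (.cell 4 (.reg 2) (.reg 1) / .sqrt (.cell 4 (.reg 1) (.reg 1))))
    (fillColumn 16 1 (.cell 5 (.reg 2) (.reg 1) / .sqrt (.cell 4 (.reg 1) (.reg 1))))

/-- The entry of `v vᴴ`, for the vector `v` in array `16`. -/
def outerEntry : RealExpr × RealExpr := cmul (vecEntry 16 2) (cconj (vecEntry 16 3))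

/-- Subtract `v vᴴ` from the matrix in the arrays `4` and `5`, for the vector `v` in
array `16`. -/
def restProg : Program :=
  .seq (fillMatrix 4 ((matEntry 4 5).1 - outerEntry.1))
    (fillMatrix 5 ((matEntry 4 5).2 - outerEntry.2))

/-- The summand of `xᴴ A y` for the vectors `x` and `y` in the arrays `a` and `b` and the matrix `A`
of the `l`-th constraint. -/
def formTerm (l a b : ℕ) : RealExpr × RealExpr :=
  cmul (cmul (cconj (vecEntry a 2)) (matEntry (10 + 2 * l) (11 + 2 * l))) (vecEntry b 3)

/-- The summands of the four entries of the row of the `l`-th constraint, for the vectors in the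
arrays `0` and `16`. -/
def formExpr (l : ℕ) : Fin 4 → RealExpr :=
  ![(formTerm l 0 0).1, (formTerm l 16 16).1, (1 + 1) * (formTerm l 0 16).1,
    0 - (1 + 1) * (formTerm l 0 16).2]

/-- Compute the listed entries of the rows of the constraints in array `17`. -/
def formsProg (L : List (Fin 3 × Fin 4)) : Program :=
  L.foldr (fun x p => .seq (sumCell 17 x.1 x.2 (formExpr x.1 x.2)) p) .skip

/-- The coefficients of the merging step, for the rows in array `17`. -/
def coeffExpr (d : ℕ) : Fin 3 → RealExpr :=
  mergeCoeff .sqrt (mergeRows d fun l q => .cell 17 (.const l) (.const q))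

/-- Compute the coefficients of the merging step in array `18`. -/
def coeffProg (d : ℕ) : Program :=
  .seq (.setCell 18 (.const 0) (.const 0) (coeffExpr d 0))
    (.seq (.setCell 18 (.const 0) (.const 1) (coeffExpr d 1))
      (.setCell 18 (.const 0) (.const 2) (coeffExpr d 2)))

/-- The `q`-th coefficient of the merging step. -/
def coeffCell (q : ℕ) : RealExpr := .cell 18 (.const 0) (.const q)

/-- Replace the vector in array `0` by its combination with the vector in array `16`. -/
def combineProg : Program :=
  .seq (fillColumn 0 0 (coeffCell 0 * (vecEntry 0 2).1 +
      (cmul (coeffCell 1, coeffCell 2) (vecEntry 16 2)).1))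
    (fillColumn 0 1 (coeffCell 0 * (vecEntry 0 2).2 +
      (cmul (coeffCell 1, coeffCell 2) (vecEntry 16 2)).2))

/-- One step: split off a Cholesky column and merge it into the vector in array `0`. -/
def stepProg (d : ℕ) : Program :=
  .seq columnProg (.seq restProg (.seq (formsProg (List.finRange 3 ×ˢ List.finRange 4))
    (.seq (coeffProg d) combineProg)))

/-- The program that computes an optimal solution of the quadratic program over the field of
dimension `d` from an optimal solution of its relaxation. -/
def solveProg (d : ℕ) : Program := forLoop 1 (stepProg d)

end RealRAM

namespace RealRAM

/-! ### Correctness of the program -/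

open Matrix

variable {𝕜 : Type*} [RCLike 𝕜] {n m : ℕ}

/-- The arrays `a` and `b` hold the real and the imaginary parts of the matrix `X`. -/
def HoldsMatrix (M : Mem) (a b : ℕ) (X : Matrix (Fin n) (Fin n) 𝕜) : Prop :=
  ∀ i j : Fin n, M a i j = RCLike.re (X i j) ∧ M b i j = RCLike.im (X i j)

/-- The columns `0` and `1` of array `a` hold the real and the imaginary parts of the vector
`x`. -/
def HoldsVector (M : Mem) (a : ℕ) (x : Fin n → 𝕜) : Prop :=
  ∀ i : Fin n, M a i 0 = RCLike.re (x i) ∧ M a i 1 = RCLike.im (x i)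

theorem HoldsMatrix.congr {M M' : Mem} {a b : ℕ} {X : Matrix (Fin n) (Fin n) 𝕜}
    (h : HoldsMatrix M a b X) (ha : M' a = M a) (hb : M' b = M b) : HoldsMatrix M' a b X :=
  fun i j => by rw [ha, hb]; exact h i j

theorem HoldsVector.congr {M M' : Mem} {a : ℕ} {x : Fin n → 𝕜}
    (h : HoldsVector M a x) (ha : M' a = M a) : HoldsVector M' a x :=
  fun i => by rw [ha]; exact h i

theorem HoldsMatrix.evalPair_matEntry {s : State} {a b : ℕ} {X : Matrix (Fin n) (Fin n) 𝕜}
    (h : HoldsMatrix s.mem a b X) {i j : Fin n} (h2 : s.idx 2 = i) (h3 : s.idx 3 = j) :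
    evalPair s (matEntry a b) = parts (X i j) := by
  simp only [evalPair, matEntry, RealExpr.eval, IdxExpr.eval, h2, h3, parts, h i j]

theorem HoldsVector.evalPair_vecEntry {s : State} {a r : ℕ} {x : Fin n → 𝕜}
    (h : HoldsVector s.mem a x) {i : Fin n} (hr : s.idx r = i) :
    evalPair s (vecEntry a r) = parts (x i) := by
  simp only [evalPair, vecEntry, RealExpr.eval, IdxExpr.eval, hr, parts, h i]

variable {ρ : ℕ → ℕ}

theorem im_div_ofReal (z : 𝕜) (r : ℝ) : RCLike.im (z / (r : 𝕜)) = RCLike.im z / r := by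
  rw [div_eq_inv_mul, div_eq_inv_mul, ← RCLike.ofReal_inv, RCLike.im_ofReal_mul]

theorem columnProg_spec {M : Mem} (hn : ρ 0 = n) {X : Matrix (Fin n) (Fin n) 𝕜} {k : Fin n}
    (hk : ρ 1 = k) (hX : HoldsMatrix M 4 5 X) :
    Triple 2 ρ (· = M) columnProg fun M' =>
      HoldsVector M' 16 (cholColumn X k) ∧ ∀ a, a ≠ 16 → M' a = M a := by
  refine Triple.seq (Triple.fillColumn (val := fun i => M 4 i k / Real.sqrt (M 4 k k)) ?_)
    (Triple.of_forall_mem fun M₁ hM₁ => (Triple.fillColumn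
      (val := fun i => M 5 i k / Real.sqrt (M 4 k k)) ?_).mono (fun _ => id) ?_)
  · intro i _ s _ h1 h2 _ hs
    simp only [eval_div, RealExpr.eval, IdxExpr.eval, h1, h2, hk]
    rw [hs _ _ _ (by omega), hs _ _ _ (by omega)]
  · intro i _ s _ h1 h2 _ hs
    simp only [eval_div, RealExpr.eval, IdxExpr.eval, h1, h2, hk]
    rw [hs _ _ _ (by omega), hs _ _ _ (by omega), hM₁.2 _ _ _ (by omega),
      hM₁.2 _ _ _ (by omega)]
  · rintro M' ⟨h1, h2⟩
    refine ⟨fun i => ⟨?_, ?_⟩, fun a ha => ?_⟩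
    · rw [h2 _ _ _ (by omega), hM₁.1 i (by omega), cholColumn, RCLike.div_re_ofReal,
        (hX i k).1, (hX k k).1]
    · rw [h1 i (by omega), cholColumn, im_div_ofReal, (hX i k).2, (hX k k).1]
    · funext i j
      rw [h2 _ _ _ (by omega), hM₁.2 _ _ _ (by omega)]

theorem restProg_spec {M : Mem} (hn : ρ 0 = n) {X : Matrix (Fin n) (Fin n) 𝕜} {v : Fin n → 𝕜}
    (hX : HoldsMatrix M 4 5 X) (hv : HoldsVector M 16 v) :
    Triple 2 ρ (· = M) restProg fun M' =>
      HoldsMatrix M' 4 5 (X - vecMulVec v (star v)) ∧ ∀ a, a ≠ 4 → a ≠ 5 → M' a = M a := by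
  have houter : ∀ s : State, s.mem 16 = M 16 → ∀ i j : Fin n, s.idx 2 = i → s.idx 3 = j →
      evalPair s outerEntry = parts (v i * star (v j)) := fun s hs i j h2 h3 => by
    have hv' : HoldsVector s.mem 16 v := hv.congr hs
    rw [outerEntry, evalPair_cmul, evalPair_cconj, hv'.evalPair_vecEntry h2,
      hv'.evalPair_vecEntry h3, cconj_parts, cmul_parts]
  set val : ℕ → ℕ → 𝕜 := fun i j =>
    if h : i < n ∧ j < n then v ⟨i, h.1⟩ * star (v ⟨j, h.2⟩) else 0 with hval
  have hval' : ∀ i j : Fin n, val i j = v i * star (v j) := fun i j => by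
    simp [hval, i.2, j.2]
  refine Triple.seq (Triple.fillMatrix (val := fun i j => M 4 i j - RCLike.re (val i j)) ?_)
    (Triple.of_forall_mem fun M₁ hM₁ => (Triple.fillMatrix
      (val := fun i j => M 5 i j - RCLike.im (val i j)) ?_).mono (fun _ => id) ?_)
  · intro i hi j hj s _ _ h2 h3 hs hs'
    rw [hn] at hi hj
    have h := congrArg Prod.fst (houter s (hs' 16 (by norm_num)) ⟨i, hi⟩ ⟨j, hj⟩ h2 h3)
    rw [← hval'] at h
    change outerEntry.1.eval s = RCLike.re (val i j) at h
    rw [eval_sub, h]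
    simp only [matEntry, RealExpr.eval, IdxExpr.eval, h2, h3, hs]
  · intro i hi j hj s _ _ h2 h3 hs hs'
    rw [hn] at hi hj
    have h := congrArg Prod.snd (houter s
      ((hs' 16 (by norm_num)).trans (hM₁.2 16 (by norm_num))) ⟨i, hi⟩ ⟨j, hj⟩ h2 h3)
    rw [← hval'] at h
    change outerEntry.2.eval s = RCLike.im (val i j) at h
    rw [eval_sub, h]
    simp only [matEntry, RealExpr.eval, IdxExpr.eval, h2, h3, hs]
    rw [hM₁.2 5 (by norm_num)]
  · rintro M' ⟨h1, h2⟩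
    refine ⟨fun i j => ⟨?_, ?_⟩, fun a h4 h5 => ?_⟩
    · rw [h2 4 (by norm_num), hM₁.1 i (by omega) j (by omega), (hX i j).1, hval']
      simp [vecMulVec_apply]
    · rw [h1 i (by omega) j (by omega), (hX i j).2, hval']
      simp [vecMulVec_apply]
    · rw [h2 a h5, hM₁.2 a h4]

/-- The entry `x` of the table of rows that is computed from the memory `M`. -/
def formVal (n : ℕ) (M : Mem) (x : Fin 3 × Fin 4) : ℝ :=
  ∑ i ∈ Finset.range n, ∑ j ∈ Finset.range n,
    (formExpr x.1 x.2).eval ⟨fun r => if r = 2 then i else j, M⟩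

theorem evalPair_formTerm {s : State} {l a b : ℕ} {A : Matrix (Fin n) (Fin n) 𝕜}
    {x y : Fin n → 𝕜} (hA : HoldsMatrix s.mem (10 + 2 * l) (11 + 2 * l) A)
    (hx : HoldsVector s.mem a x) (hy : HoldsVector s.mem b y) {i j : Fin n}
    (h2 : s.idx 2 = i) (h3 : s.idx 3 = j) :
    evalPair s (formTerm l a b) = parts (star (x i) * A i j * y j) := by
  rw [formTerm, evalPair_cmul, evalPair_cmul, evalPair_cconj, hx.evalPair_vecEntry h2,
    hA.evalPair_matEntry h2 h3, hy.evalPair_vecEntry h3, cconj_parts, cmul_parts, cmul_parts]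

theorem star_dotProduct_mulVec_eq_sum (A : Matrix (Fin n) (Fin n) 𝕜) (x y : Fin n → 𝕜) :
    star x ⬝ᵥ (A *ᵥ y) = ∑ i, ∑ j, star (x i) * A i j * y j := by
  simp only [dotProduct, mulVec, Finset.mul_sum, Pi.star_apply, mul_assoc]

theorem formVal_eq {M : Mem} {l : Fin 3} {A : Matrix (Fin n) (Fin n) 𝕜} {w v : Fin n → 𝕜}
    (hA : HoldsMatrix M (10 + 2 * l) (11 + 2 * l) A) (hw : HoldsVector M 0 w)
    (hv : HoldsVector M 16 v) (q : Fin 4) : formVal n M (l, q) = formRow A w v q := by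
  have key : ∀ {a b : ℕ} {x y : Fin n → 𝕜}, HoldsVector M a x → HoldsVector M b y →
      ∀ i j : Fin n, evalPair ⟨fun r => if r = 2 then (i : ℕ) else j, M⟩ (formTerm l a b) =
        parts (star (x i) * A i j * y j) := fun hx hy i j =>
    evalPair_formTerm (s := ⟨fun r => if r = 2 then (i : ℕ) else j, M⟩) hA hx hy
      (by simp) (by simp)
  have kre := fun {a b : ℕ} {x y : Fin n → 𝕜} (hx : HoldsVector M a x) (hy : HoldsVector M b y)
    (i j : Fin n) => congrArg Prod.fst (key hx hy i j)
  have kim := fun {a b : ℕ} {x y : Fin n → 𝕜} (hx : HoldsVector M a x) (hy : HoldsVector M b y)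
    (i j : Fin n) => congrArg Prod.snd (key hx hy i j)
  simp only [evalPair, parts] at kre kim
  simp only [formVal, Finset.sum_range]
  fin_cases q
  · change ∑ i : Fin n, ∑ j : Fin n, (formTerm l 0 0).1.eval _ = RCLike.re (star w ⬝ᵥ (A *ᵥ w))
    simp only [star_dotProduct_mulVec_eq_sum, map_sum, kre hw hw]
  · change ∑ i : Fin n, ∑ j : Fin n, (formTerm l 16 16).1.eval _ = RCLike.re (star v ⬝ᵥ (A *ᵥ v))
    simp only [star_dotProduct_mulVec_eq_sum, map_sum, kre hv hv]
  · change ∑ i : Fin n, ∑ j : Fin n, ((1 + 1) * (formTerm l 0 16).1 : RealExpr).eval _ =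
      2 * RCLike.re (star w ⬝ᵥ (A *ᵥ v))
    simp only [star_dotProduct_mulVec_eq_sum, map_sum, eval_mul, eval_add, eval_one, kre hw hv,
      Finset.mul_sum, one_add_one_eq_two]
  · change ∑ i : Fin n, ∑ j : Fin n, (0 - (1 + 1) * (formTerm l 0 16).2 : RealExpr).eval _ =
      -(2 * RCLike.im (star w ⬝ᵥ (A *ᵥ v)))
    simp only [star_dotProduct_mulVec_eq_sum, map_sum, eval_sub, eval_zero, eval_mul, eval_add,
      eval_one, kim hw hv, Finset.mul_sum, one_add_one_eq_two, zero_sub, Finset.sum_neg_distrib]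

theorem formsProg_spec (L : List (Fin 3 × Fin 4)) (M : Mem) (S : Set (Fin 3 × Fin 4)) :
    Triple 2 ρ (fun M' => (∀ a, a ≠ 17 → M' a = M a) ∧ ∀ x ∈ S, M' 17 x.1 x.2 = formVal (ρ 0) M x)
      (formsProg L) fun M' => (∀ a, a ≠ 17 → M' a = M a) ∧
        ∀ x, x ∈ S ∨ x ∈ L → M' 17 x.1 x.2 = formVal (ρ 0) M x := by
  induction L generalizing S with
  | nil => exact Triple.skip.mono (fun _ => id) (by simp)
  | cons x L ih =>
    refine Triple.seq (Triple.of_forall_mem fun M₁ hM₁ => (Triple.sumCell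
      (val := fun i j => (formExpr x.1 x.2).eval ⟨fun r => if r = 2 then i else j, M⟩)
      ?_).mono (fun _ => id) ?_) ((ih (insert x S)).mono (fun _ => id) ?_)
    · intro i _ j _ s h2 h3 hs
      have hmem : ∀ a, a ≠ 17 → s.mem a = M a := fun a ha => (hs a ha).trans (hM₁.1 a ha)
      have hl := x.1.2
      have h0 := hmem 0 (by norm_num)
      have h16 := hmem 16 (by norm_num)
      have hre := hmem (10 + 2 * x.1) (by omega)
      have him := hmem (11 + 2 * x.1) (by omega)
      obtain ⟨l, q⟩ := x
      fin_cases q <;>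
        simp [formExpr, formTerm, vecEntry, matEntry, cmul, cconj, eval_mul, eval_sub,
          RealExpr.eval, IdxExpr.eval, h2, h3, h0, h16, hre, him]
    · rintro M' ⟨h1, h2⟩
      refine ⟨fun a ha => ?_, fun y hy => ?_⟩
      · rw [← hM₁.1 a ha]
        funext i j
        exact h2 a i j (by tauto)
      · by_cases hyx : y = x
        · rw [hyx, h1, formVal]
        · have hyS : y ∈ S := hy.resolve_left hyx
          rw [h2, hM₁.2 y hyS]
          rintro ⟨-, e1, e2⟩
          exact hyx (Prod.ext (Fin.ext e1) (Fin.ext e2))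
    · rintro M' ⟨h1, h2⟩
      refine ⟨h1, fun y hy => h2 y ?_⟩
      rw [List.mem_cons] at hy
      rw [Set.mem_insert_iff]
      tauto

theorem coeffProg_spec (d : ℕ) {M : Mem} {F : Fin 3 → Fin 4 → ℝ}
    (hF : ∀ (l : Fin 3) (q : Fin 4), M 17 l q = F l q) :
    Triple 2 ρ (· = M) (coeffProg d) fun M' =>
      (∀ q : Fin 3, M' 18 0 q = mergeCoeff Real.sqrt (mergeRows d F) q) ∧
        ∀ a, a ≠ 18 → M' a = M a := by
  have heval : ∀ s : State, s.mem 17 = M 17 → ∀ q,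
      (coeffExpr d q).eval s = mergeCoeff Real.sqrt (mergeRows d F) q := fun s hs q => by
    change evalFamily s (coeffExpr d) q = _
    rw [coeffExpr, evalFamily_mergeCoeff]
    congr 2
    funext l
    rw [evalFamily_mergeRows]
    congr 1
    funext l q
    simp only [evalFamily, RealExpr.eval, IdxExpr.eval, hs, hF]
  refine Triple.seq (Mid := fun M' => M' 18 0 0 = mergeCoeff Real.sqrt (mergeRows d F) 0 ∧
      ∀ a, a ≠ 18 → M' a = M a) (Triple.setCell ?_) (Triple.seq
    (Mid := fun M' => M' 18 0 0 = mergeCoeff Real.sqrt (mergeRows d F) 0 ∧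
      M' 18 0 1 = mergeCoeff Real.sqrt (mergeRows d F) 1 ∧ ∀ a, a ≠ 18 → M' a = M a)
    (Triple.setCell ?_) (Triple.setCell ?_))
  · rintro s - rfl
    rw [heval s rfl]
    refine ⟨by simp [State.writeCell, IdxExpr.eval], fun a ha => ?_⟩
    funext i j
    simp [State.writeCell, ha]
  · rintro s - ⟨h0, hs⟩
    rw [heval s (hs 17 (by norm_num))]
    refine ⟨by simp [State.writeCell, IdxExpr.eval, h0],
      by simp [State.writeCell, IdxExpr.eval], fun a ha => ?_⟩
    funext i j
    simp [State.writeCell, ha, hs a ha]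
  · rintro s - ⟨h0, h1, hs⟩
    rw [heval s (hs 17 (by norm_num))]
    refine ⟨fun q => ?_, fun a ha => ?_⟩
    · fin_cases q <;> simp [State.writeCell, IdxExpr.eval, h0, h1]
    · funext i j
      simp [State.writeCell, ha, hs a ha]

theorem combineProg_spec {M : Mem} (hn : ρ 0 = n) {w v : Fin n → 𝕜} {z : Fin 3 → ℝ}
    (hw : HoldsVector M 0 w) (hv : HoldsVector M 16 v) (hz : ∀ q : Fin 3, M 18 0 q = z q)
    (him : RCLike.im (ofParts (z 1) (z 2) : 𝕜) = z 2) :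
    Triple 2 ρ (· = M) combineProg fun M' =>
      HoldsVector M' 0 (combine z w v) ∧ ∀ a, a ≠ 0 → M' a = M a := by
  have hz0 : M 18 0 0 = z 0 := hz 0
  have hz1 : M 18 0 1 = z 1 := hz 1
  have hz2 : M 18 0 2 = z 2 := hz 2
  refine Triple.seq (Triple.fillColumn
      (val := fun i => z 0 * M 0 i 0 + (z 1 * M 16 i 0 - z 2 * M 16 i 1)) ?_)
    (Triple.of_forall_mem fun M₁ hM₁ => (Triple.fillColumn
      (val := fun i => z 0 * M 0 i 1 + (z 1 * M 16 i 1 + z 2 * M 16 i 0)) ?_).mono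
      (fun _ => id) ?_)
  · intro i _ s _ _ h2 h hs
    simp only [eval_sub, coeffCell, vecEntry, cmul, RealExpr.eval, IdxExpr.eval, h2, h]
    rw [hs 18 _ _ (by omega), hs 18 _ _ (by omega), hs 18 _ _ (by omega), hs 16 _ _ (by omega),
      hs 16 _ _ (by omega), hz0, hz1, hz2]
  · intro i _ s _ _ h2 h hs
    simp only [eval_add, coeffCell, vecEntry, cmul, RealExpr.eval, IdxExpr.eval, h2, h]
    have hs' : ∀ a, a ≠ 0 → ∀ i j, s.mem a i j = M a i j := fun a ha i j => by
      rw [hs _ _ _ (by omega), hM₁.2 _ _ _ (by omega)]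
    rw [hM₁.2 0 _ 1 (by omega), hs' 18 (by norm_num), hs' 18 (by norm_num), hs' 18 (by norm_num),
      hs' 16 (by norm_num), hs' 16 (by norm_num), hz0, hz1, hz2]
  · rintro M' ⟨h1, h2⟩
    refine ⟨fun i => ⟨?_, ?_⟩, fun a ha => ?_⟩
    · rw [h2 _ _ _ (by omega), hM₁.1 i (by omega), (hw i).1, (hv i).1, (hv i).2]
      simp [combine, RCLike.mul_re, RCLike.smul_re, re_ofParts, him]
    · rw [h1 i (by omega), (hw i).2, (hv i).1, (hv i).2]
      simp [combine, RCLike.mul_im, RCLike.smul_im, re_ofParts, him]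
    · funext i j
      rw [h2 _ _ _ (by omega), hM₁.2 _ _ _ (by omega)]

end RealRAM

namespace RealRAM

section Solve

open Matrix

variable {𝕜 : Type*} [RCLike 𝕜] {n : ℕ} {ρ : ℕ → ℕ}

/-- The invariant of the main loop after `k` steps, where `X₀` is the given optimal solution of the
relaxation: the arrays `4` and `5` hold a matrix `X ≤ X₀` whose first `k` columns vanish, and
array `0` holds a vector `w` in the range of `X₀` such that `w wᴴ + X` and `X₀` agree on all
constraint matrices. -/
def Invariant (P : HQP 𝕜 n (fieldDim 𝕜 + 1)) (X₀ : Matrix (Fin n) (Fin n) 𝕜) (k : ℕ) (M : Mem) :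
    Prop :=
  (∀ l : Fin (fieldDim 𝕜 + 1), HoldsMatrix M (10 + 2 * l) (11 + 2 * l) (P.A l)) ∧
    ∃ (X : Matrix (Fin n) (Fin n) 𝕜) (w : Fin n → 𝕜), HoldsMatrix M 4 5 X ∧ HoldsVector M 0 w ∧
      X.PosSemidef ∧ (X₀ - X).PosSemidef ∧ (∀ l : Fin n, l < k → ∀ i, X i l = 0) ∧
      DominatedBy w X₀ ∧ ∀ l, quadForm (P.A l) w + matInner (P.A l) X = matInner (P.A l) X₀

theorem stepProg_spec (hn : ρ 0 = n) {k : Fin n} (hk : ρ 1 = k) (P : HQP 𝕜 n (fieldDim 𝕜 + 1))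
    (X₀ : Matrix (Fin n) (Fin n) 𝕜) :
    Triple 2 ρ (Invariant P X₀ k) (stepProg (fieldDim 𝕜)) (Invariant P X₀ (k + 1)) := by
  refine Triple.of_forall_mem fun M hM => ?_
  obtain ⟨hA, X, w, hX, hw, hXp, hXX, hX0, hdom, hval⟩ := hM
  have hd := fieldDim_le_two (𝕜 := 𝕜)
  have hA' : ∀ M' : Mem, (∀ a, 10 ≤ a → a < 16 → M' a = M a) →
      ∀ l : Fin (fieldDim 𝕜 + 1), HoldsMatrix M' (10 + 2 * l) (11 + 2 * l) (P.A l) :=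
    fun M' h l => by
    have := l.2
    exact (hA l).congr (h _ (by omega) (by omega)) (h _ (by omega) (by omega))
  refine Triple.seq (columnProg_spec hn hk hX) (Triple.of_forall_mem fun M₁ ⟨hv₁, hM₁⟩ => ?_)
  refine Triple.seq (restProg_spec hn (hX.congr (hM₁ 4 (by norm_num)) (hM₁ 5 (by norm_num))) hv₁)
    (Triple.of_forall_mem fun M₂ ⟨hX₂, hM₂⟩ => ?_)
  have hM₂' : ∀ a, a ≠ 4 → a ≠ 5 → a ≠ 16 → M₂ a = M a := fun a h4 h5 h16 =>
    (hM₂ a h4 h5).trans (hM₁ a h16)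
  have hw₂ : HoldsVector M₂ 0 w := hw.congr (hM₂' 0 (by norm_num) (by norm_num) (by norm_num))
  have hv₂ : HoldsVector M₂ 16 (cholColumn X k) := hv₁.congr (hM₂ 16 (by norm_num) (by norm_num))
  have hA₂ := hA' M₂ fun a _ _ => hM₂' a (by omega) (by omega) (by omega)
  refine Triple.seq ((formsProg_spec _ M₂ ∅).mono (by rintro _ rfl; simp) fun _ => id)
    (Triple.of_forall_mem fun M₃ ⟨hM₃, hF₃⟩ => ?_)
  -- the table of rows, including those of matrices that are not part of the problem
  set F : Fin 3 → Fin 4 → ℝ := fun l q => formVal n M₂ (l, q) with hF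
  refine Triple.seq (coeffProg_spec (F := F) (fieldDim 𝕜) fun l q => by
      rw [hF, ← hn]; exact hF₃ (l, q) (by simp))
    (Triple.of_forall_mem fun M₄ ⟨hz₄, hM₄⟩ => ?_)
  have hM₄' : ∀ a, a ≠ 17 → a ≠ 18 → M₄ a = M₂ a := fun a h17 h18 =>
    (hM₄ a h18).trans (hM₃ a h17)
  refine (combineProg_spec hn (hw₂.congr (hM₄' 0 (by norm_num) (by norm_num)))
    (hv₂.congr (hM₄' 16 (by norm_num) (by norm_num))) hz₄
    (im_ofParts_mergeCoeff F)).mono (fun _ => id) ?_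
  rintro M₅ ⟨hw₅, hM₅⟩
  have hM₅' : ∀ a, a ≠ 0 → a ≠ 17 → a ≠ 18 → M₅ a = M₂ a := fun a h0 h17 h18 =>
    (hM₅ a h0).trans (hM₄' a h17 h18)
  have hrest : X₀ - cholRest X k - vecMulVec (cholColumn X k) (star (cholColumn X k)) = X₀ - X := by
    rw [cholRest]; abel
  refine ⟨hA' M₅ fun a _ _ => (hM₅' a (by omega) (by omega) (by omega)).trans
      (hM₂' a (by omega) (by omega) (by omega)), cholRest X k, _,
    hX₂.congr (hM₅' 4 (by norm_num) (by norm_num) (by norm_num))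
      (hM₅' 5 (by norm_num) (by norm_num) (by norm_num)), hw₅, cholRest_posSemidef hXp k, ?_, ?_,
    ?_, ?_⟩
  · have h := hXX.add (posSemidef_vecMulVec_self_star (cholColumn X k))
    rwa [← hrest, sub_add_cancel] at h
  · intro l hl i
    rcases Nat.lt_succ_iff_lt_or_eq.1 hl with h | h
    · exact cholRest_apply_eq_zero hXp (hX0 l h) i
    · rw [Fin.ext h]
      exact cholRest_apply_self hXp k i
  · refine hdom.combination ⟨1, zero_le_one, ?_⟩ _ _
    have h := hXX.add (cholRest_posSemidef hXp k)
    rwa [← hrest, sub_right_comm, sub_add_cancel, ← one_smul ℝ X₀] at h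
  · intro l
    have hl := l.2
    have hrow : F ⟨l, by omega⟩ = formRow (P.A l) w (cholColumn X k) := by
      funext q
      exact formVal_eq (l := ⟨l, by omega⟩) (hA₂ l) hw₂ hv₂ q
    rw [quadForm_combine (P.hermitian l) hl hrow, cholRest, matInner_sub, matInner_vecMulVec,
      ← hval l]
    ring

/-- The program computes an optimal solution in polynomial time. -/
theorem solveProg_spec (P : HQP 𝕜 n (fieldDim 𝕜 + 1)) {X : Matrix (Fin n) (Fin n) 𝕜}
    (hX : P.IsSDPOptimal X) (Z : Matrix (Fin n) (Fin n) 𝕜) (μ : Fin (fieldDim 𝕜 + 1) → ℝ) :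
    ∃ (t : ℕ) (s : State), Runs (solveProg (fieldDim 𝕜)) (initialState P X Z μ) t s ∧
      t ≤ (timeBound (solveProg (fieldDim 𝕜))).eval n ∧
      ∃ x : Fin n → 𝕜, Outputs s x ∧ P.IsOptimal x ∧ quadForm P.A₀ x = matInner P.A₀ X := by
  have htriple : Triple 1 (fun _ => n) (Invariant P X 0) (solveProg (fieldDim 𝕜))
      (Invariant P X n) :=
    Triple.forLoop one_pos fun k hk =>
      stepProg_spec (k := ⟨k, hk⟩) (by simp) (by simp) P X
  obtain ⟨t, s, hrun, ht, -, -, Y, w, -, hw, -, -, hY, hdom, hval⟩ :=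
    htriple (initialState P X Z μ) (fun r hr => by simp [initialState, Nat.lt_one_iff.1 hr]) <| by
      refine ⟨fun l i j => ?_, X, 0, fun i j => ?_, fun i => ?_, hX.1.1, ?_, ?_, .zero X,
        fun l => ?_⟩
      · have h1 : 10 + 2 * (l : ℕ) = 2 * l + 10 := by omega
        have h2 : 11 + 2 * (l : ℕ) = (2 * l + 1) + 10 := by omega
        have h3 : (2 * (l : ℕ) + 1) / 2 = l := by omega
        have h4 : (l : ℕ) ≤ fieldDim 𝕜 := Nat.lt_succ_iff.1 l.2
        rw [h1, h2]
        simp [initialState, ofMatrices, ofMatrix, rePart, imPart, h3, h4]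
      · simp [initialState, ofMatrix, rePart, imPart]
      · simp [initialState]
      · rw [sub_self]; exact .zero
      · exact fun l hl => absurd hl (Nat.not_lt_zero l)
      · simp [quadForm]
  have hY0 : Y = 0 := by
    ext i l
    exact hY l l.2 i
  refine ⟨t, s, hrun, ht, w, hw, hX.isOptimal_of_dominatedBy hdom fun l => ?_⟩
  rw [← hval l, hY0, matInner_zero, add_zero]

end Solve

end RealRAM

end

theorem mainTheorem2 (𝕜 : Type*) [RCLike 𝕜] :
    (∀ (n : ℕ) (P : HQP 𝕜 n (fieldDim 𝕜 + 1)),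
      P.c (Fin.last (fieldDim 𝕜)) ≠ 0 → P.PrimalSlater → P.DualSlater →
        (∃ x, P.IsOptimal x) ∧ P.value = P.sdpValue) ∧
    (∃ (prog : RealRAM.Program) (bound : Polynomial ℕ),
      ∀ (n : ℕ) (P : HQP 𝕜 n (fieldDim 𝕜 + 1)),
        P.c (Fin.last (fieldDim 𝕜)) ≠ 0 → P.PrimalSlater → P.DualSlater →
        ∀ (X Z : Matrix (Fin n) (Fin n) 𝕜) (μ : Fin (fieldDim 𝕜 + 1) → ℝ),
          P.IsSDPOptimal X → P.IsDualOptimal Z μ →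
          ∃ (t : ℕ) (s : RealRAM.State),
            RealRAM.Runs prog (RealRAM.initialState P X Z μ) t s ∧
            t ≤ bound.eval n ∧
            ∃ x : Fin n → 𝕜, RealRAM.Outputs s x ∧ P.IsOptimal x) := by
  refine ⟨fun n P _ hp hd => ?_, RealRAM.solveProg (fieldDim 𝕜),
    RealRAM.timeBound (RealRAM.solveProg (fieldDim 𝕜)), fun n P _ _ _ X Z μ hX _ => ?_⟩
  · obtain ⟨X, hX⟩ := HQP.exists_isSDPOptimal hp hd
    obtain ⟨-, -, -, -, x, -, hx, hval⟩ := RealRAM.solveProg_spec P hX 0 0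
    exact ⟨⟨x, hx⟩, by
      rw [HQP.value_eq_of_isOptimal hx, HQP.sdpValue_eq_of_isSDPOptimal hX, hval]⟩
  · obtain ⟨t, s, hrun, ht, x, hout, hx, -⟩ := RealRAM.solveProg_spec P hX Z μ
    exact ⟨t, s, hrun, ht, x, hout, hx⟩
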